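/- **Theorem (Estimation and inference for cross-fitted estimators).** *Setting.* Let $W_1,W_2,\dots$ be i.i.d. copies of an observation $W$, which contains a real outcome $\tilde Y$, binary variables $G_\tau$ ($\tau\in\mathcal T$, $\mathcal T$ finite, with a distinguished index $1\in\mathcal T$) and covariates $X$. The covariate vector $X=X_N$, e.g. its dimension, may change with the sample size $N$. Put $q_{G_\tau}(x)=\Pr(G_\tau=1\mid X=x)$, $m_\tau(x)=\mathbb E[\tilde Y\mid G_\tau=1,X=x]$, $q_1(x)=q_{G_1}(x)$ and $q_1=\Pr(G_1=1)$. Let $\eta$ be a nuisance parameter that contains all $q_{G_\tau}(\cdot)$, all $m_\tau(\cdot)$ and possibly further components, let $\psi^b(W,\eta)$ be an adjustment term, and let $a_\tau$ be real constants (e.g. signs $\pm1$). Define $$\psi(W,\eta)=\sum_{\tau\in\mathcal T}a_\tau\Big[\frac{q_1(X)}{q_1}\frac{G_\tau}{q_{G_\tau}(X)}\big(\tilde Y-m_\tau(X)\big)+\psi^b(W,\eta)\,m_\tau(X)\Big],\qquad \psi(W,\eta;\theta)=\psi(W,\eta)-\psi^b(W,\eta)\,\theta .$$ For fixed $K\ge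 1$ and $N=Kn$, split $\{1,\dots,N\}$, possibly at random but independently of the data, into folds $\mathcal I^1,\dots,\mathcal I^K$ of size $n$. For each $k$ let $\hat\eta_{-k}$ be an estimator of $\eta$ that uses only the observations outside $\mathcal I^k$ (and possibly randomization independent of the data). Put $$\hat\theta=\frac{\frac1N\sum_{k=1}^K\sum_{i\in\mathcal I^k}\psi(W_i,\hat\eta_{-k})}{\frac1N\sum_{k=1}^K\sum_{i\in\mathcal I^k}\psi^b(W_i,\hat\eta_{-k})}.$$ Below, expectations and $L_p$ norms of quantities involving $\hat\eta_{-k}$ are taken over a new observation $W$ with $\hat\eta_{-k}$ held fixed, and are therefore random. Limits are for $n\to\infty$, and the constants $c>0$, $C$ do not depend on $N$. *Assumptions.* $\mathbb E[\psi(W,\eta;\theta)]=0$ and $\mathbb E[\tilde Y^2]<\infty$; moreover, for all $\tau\in\mathcal T$ and $k=1,\dots,K$: 1. almost surely $c\le q_{G_\tau}(X)\le 1-c$ and $c\le\hat q_{G_\tau}(X)_{-k}\le 1-c$; 2. $\mathbb E[\psi^b(W,\eta)\mid X]=q_1(X)/q_1$ and $\Big\|\frac{G_\tau}{q_1}\frac{q_1(X)}{q_{G_\tau}(X)}-\psi^b(W,\eta)\Big\|_\infty\le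 C$; 3. with $\delta_k=\psi^b(W,\hat\eta_{-k})-\psi^b(W,\eta)$: $\|\delta_k\|_2=o_p(1)$, $\|\delta_k\|_\infty=O_p(1)$, $\mathbb E[\delta_k]=o_p(N^{-1/2})$, $\mathbb E[\delta_k\,\hat m_\tau(X)_{-k}]=o_p(N^{-1/2})$ and $\|\delta_k\,m_\tau(X)\|_2=o_p(1)$; 4. $\|\hat m_\tau(X)_{-k}-m_\tau(X)\|_2=o_p(1)$ and $\Big\|\frac{\hat q_1(X)_{-k}}{\hat q_{G_\tau}(X)_{-k}}-\frac{q_1(X)}{q_{G_\tau}(X)}\Big\|_2=o_p(1)$; 5. $\Big\|\frac{\hat q_1(X)_{-k}}{\hat q_{G_\tau}(X)_{-k}}-\frac{q_1(X)}{q_{G_\tau}(X)}\Big\|_2\times\|\hat m_\tau(X)_{-k}-m_\tau(X)\|_2=o_p(N^{-1/2})$. *Conclusion.* $$\sqrt N\,(\hat\theta-\theta)=\frac1{\sqrt N}\sum_{i=1}^N\psi(W_i,\eta;\theta)+o_p(1)\ \overset{d}{\longrightarrow}\ \mathcal N(0,\sigma^2),\qquad \sigma^2=\mathbb E[\psi(W,\eta;\theta)^2].$$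 If the covariates, and with them the score, change with $N$, the expansion holds as stated, and convergence in distribution holds whenever $\mathbb E[\psi(W,\eta;\theta)^2]\to\sigma^2$. -/

import Mathlib

open MeasureTheory ProbabilityTheory Filter Topology
open scoped ENNReal NNReal

noncomputable section

namespace CrossFitting

/-! ### Stochastic order symbols -/

/-- `f n = o_p(a n)` for random variables with values in `[0, ∞]`. -/
def LittleOp {Ω : Type*} [MeasurableSpace Ω] (μ : Measure Ω)
    (f : ℕ → Ω → ℝ≥0∞) (a : ℕ → ℝ) : Prop :=
  ∀ ε : ℝ, 0 < ε →
    Tendsto (fun n => μ {ω | ENNReal.ofReal (ε * a n) ≤ f n ω}) atTop (𝓝 0)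

/-- `f n = O_p(1)` for random variables with values in `[0, ∞]`. -/
def BigOpOne {Ω : Type*} [MeasurableSpace Ω] (μ : Measure Ω) (f : ℕ → Ω → ℝ≥0∞) : Prop :=
  ∀ ε : ℝ≥0∞, 0 < ε → ∃ M : ℝ≥0, ∀ᶠ n in atTop, μ {ω | (M : ℝ≥0∞) < f n ω} ≤ ε

/-! ### Nuisance parameters, model and score -/

/-- A value of the nuisance parameter `η`: the propensity functions `x ↦ q_{G_τ}(x)`, the outcome
regressions `x ↦ m_Ỹ(G_τ = 1, x)`, and anything else (`aux`) that the adjustment term may use. -/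
structure Nuisance (T 𝒳 Z : Type*) where
  q : T → 𝒳 → ℝ
  m : T → 𝒳 → ℝ
  aux : Z

/-- The population and the score. One observation `W` takes values in `𝒲` and has distribution
`law`. The index `n` (the size of one fold) lets the covariate vector `X n` that is conditioned
on, and with it the nuisance parameter and the adjustment term, change with the sample size, for
instance `𝒳 n = Fin (d n) → ℝ` with `d n → ∞`. If nothing depends on `n` this is a fixed model. -/
structure Model (T 𝒲 : Type*) (𝒳 Z : ℕ → Type*) [MeasurableSpace 𝒲]
    [∀ n, MeasurableSpace (𝒳 n)] where
  /-- distribution of one observation -/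
  law : Measure 𝒲
  /-- the outcome -/
  Y : 𝒲 → ℝ
  /-- the event `G_τ = 1` -/
  group : T → Set 𝒲
  /-- the covariates -/
  X : ∀ n, 𝒲 → 𝒳 n
  /-- the index `τ` for which `q_{G_τ}` is abbreviated by `q_1` -/
  one : T
  /-- coefficient of the term with index `τ` in the sum, such as `(-1)^(d+t)` for `τ = (d,t)` -/
  coef : T → ℝ
  /-- the adjustment term `ψ^b(W, η)` -/
  psib : ∀ n, 𝒲 → Nuisance T (𝒳 n) (Z n) → ℝ
  /-- the true nuisance parameter -/
  eta : ∀ n, Nuisance T (𝒳 n) (Z n)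
  law_isProb : IsProbabilityMeasure law
  measurable_Y : Measurable Y
  measurableSet_group : ∀ τ, MeasurableSet (group τ)
  measurable_X : ∀ n, Measurable (X n)
  measurable_psib_eta : ∀ n, Measurable fun w => psib n w (eta n)
  measurable_q : ∀ n τ, Measurable ((eta n).q τ)
  measurable_m : ∀ n τ, Measurable ((eta n).m τ)

namespace Model

variable {T 𝒲 : Type*} {𝒳 Z : ℕ → Type*} [MeasurableSpace 𝒲] [∀ n, MeasurableSpace (𝒳 n)]

/-- The binary variable `G_τ`. -/
def G (S : Model T 𝒲 𝒳 Z) (τ : T) : 𝒲 → ℝ := (S.group τ).indicator fun _ => 1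

/-- The number `q_1 = Pr(G_1 = 1)`. -/
def q1 (S : Model T 𝒲 𝒳 Z) : ℝ := S.law.real (S.group S.one)

/-- The ratio `q_1(X) / q_{G_τ}(X)`, computed from the nuisance parameter `η`. -/
def ratio (S : Model T 𝒲 𝒳 Z) (n : ℕ) (η : Nuisance T (𝒳 n) (Z n)) (τ : T) (w : 𝒲) : ℝ :=
  η.q S.one (S.X n w) / η.q τ (S.X n w)

/-- `ψ(W, η)`: the sum over `τ` of `coef τ` times
`q_1(X)/q_1 * G_τ/q_{G_τ}(X) * (Ỹ - m_Ỹ(G_τ=1,X)) + ψ^b(W,η) * m_Ỹ(G_τ=1,X)`. -/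
def psi [Fintype T] (S : Model T 𝒲 𝒳 Z) (n : ℕ) (w : 𝒲) (η : Nuisance T (𝒳 n) (Z n)) : ℝ :=
  ∑ τ, S.coef τ *
    (η.q S.one (S.X n w) / S.q1 * (S.G τ w / η.q τ (S.X n w)) * (S.Y w - η.m τ (S.X n w))
      + S.psib n w η * η.m τ (S.X n w))

/-- The score `ψ(W, η; θ) = ψ(W, η) - ψ^b(W, η) θ`. -/
def score [Fintype T] (S : Model T 𝒲 𝒳 Z) (n : ℕ) (w : 𝒲) (η : Nuisance T (𝒳 n) (Z n))
    (θ : ℝ) : ℝ :=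
  S.psi n w η - S.psib n w η * θ

/-- The σ-algebra on `𝒲` generated by the covariates. -/
abbrev sigmaX (S : Model T 𝒲 𝒳 Z) (n : ℕ) : MeasurableSpace 𝒲 :=
  MeasurableSpace.comap (S.X n) inferInstance

/-- `eta n` is the truth: `q_{G_τ}(X) = Pr(G_τ = 1 | X)`, and `m_Ỹ(G_τ = 1, X)` is the conditional
expectation of `Ỹ` given `X` under the conditional distribution given `G_τ = 1`. -/
def TrueNuisance (S : Model T 𝒲 𝒳 Z) : Prop :=
  ∀ n τ,
    (fun w => (S.eta n).q τ (S.X n w)) =ᵐ[S.law] S.law[S.G τ | S.sigmaX n] ∧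
    (fun w => (S.eta n).m τ (S.X n w)) =ᵐ[S.law[|S.group τ]] (S.law[|S.group τ])[S.Y | S.sigmaX n]

/-- The propensity scores are bounded away from zero and one. -/
def PropensityBounded (S : Model T 𝒲 𝒳 Z) : Prop :=
  ∃ c : ℝ, 0 < c ∧ ∀ n τ, ∀ᵐ w ∂S.law,
    c ≤ (S.eta n).q τ (S.X n w) ∧ (S.eta n).q τ (S.X n w) ≤ 1 - c

/-- `E[ψ^b(W, η) | X] = q_1(X) / q_1`. -/
def AdjustmentMean (S : Model T 𝒲 𝒳 Z) : Prop :=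
  ∀ n, S.law[fun w => S.psib n w (S.eta n) | S.sigmaX n] =ᵐ[S.law]
    fun w => (S.eta n).q S.one (S.X n w) / S.q1

/-- `‖ G_τ / q_1 * q_1(X) / q_{G_τ}(X) - ψ^b(W, η) ‖_∞ ≤ C`. -/
def AdjustmentBounded (S : Model T 𝒲 𝒳 Z) : Prop :=
  ∃ C : ℝ, ∀ n τ, ∀ᵐ w ∂S.law,
    |S.G τ w / S.q1 * S.ratio n (S.eta n) τ w - S.psib n w (S.eta n)| ≤ C

end Model

/-! ### The cross-fitting algorithm -/

/-- A cross-fitting procedure with `K` folds of size `n`, sample size `K * n`. External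
randomization (the random split, and possibly randomized first-stage learners) enters through
`r : 𝓡`. The first-stage estimator for fold `k` uses only observations outside fold `k`. -/
structure CrossFit {T 𝒲 : Type*} {𝒳 Z : ℕ → Type*} [MeasurableSpace 𝒲]
    [∀ n, MeasurableSpace (𝒳 n)] (S : Model T 𝒲 𝒳 Z) (K : ℕ) (𝓡 : Type*)
    [MeasurableSpace 𝓡] where
  /-- the fold to which an observation is assigned -/
  split : ∀ n, 𝓡 → Fin (K * n) → Fin K
  /-- the first-stage estimator that leaves out fold `k` -/
  etaHat : ∀ n, Fin K → 𝓡 → (Fin (K * n) → 𝒲) → Nuisance T (𝒳 n) (Z n)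
  card_fold : ∀ n r k, (Finset.univ.filter fun i => split n r i = k).card = n
  dependsOn : ∀ n k r, DependsOn (etaHat n k r) {i | split n r i ≠ k}
  measurable_split : ∀ n, Measurable (split n)
  measurable_qHat : ∀ n k τ,
    Measurable fun p : 𝓡 × (Fin (K * n) → 𝒲) × 𝒳 n => (etaHat n k p.1 p.2.1).q τ p.2.2
  measurable_mHat : ∀ n k τ,
    Measurable fun p : 𝓡 × (Fin (K * n) → 𝒲) × 𝒳 n => (etaHat n k p.1 p.2.1).m τ p.2.2
  measurable_psibHat : ∀ n k,
    Measurable fun p : 𝓡 × (Fin (K * n) → 𝒲) × 𝒲 => S.psib n p.2.2 (etaHat n k p.1 p.2.1)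

namespace CrossFit

variable {T 𝒲 : Type*} {𝒳 Z : ℕ → Type*} [MeasurableSpace 𝒲] [∀ n, MeasurableSpace (𝒳 n)]
  {S : Model T 𝒲 𝒳 Z} {K : ℕ} {𝓡 : Type*} [MeasurableSpace 𝓡]
  {Ω : Type*} [MeasurableSpace Ω]

/-- The cross-fitted estimator `θ̂`: the ratio of the cross-fitted sample averages of
`ψ(W_i, η̂_{-k})` and of `ψ^b(W_i, η̂_{-k})`. -/
def thetaHat [Fintype T] (F : CrossFit S K 𝓡) (n : ℕ) (r : 𝓡) (w : Fin (K * n) → 𝒲) : ℝ :=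
  (1 / ((K * n : ℕ) : ℝ) * ∑ k, ∑ i with F.split n r i = k, S.psi n (w i) (F.etaHat n k r w)) /
  (1 / ((K * n : ℕ) : ℝ) * ∑ k, ∑ i with F.split n r i = k, S.psib n (w i) (F.etaHat n k r w))

/-- The first-stage estimator as a random element, for the sample `W 0, …, W (K n - 1)`. -/
def fit (F : CrossFit S K 𝓡) (R : Ω → 𝓡) (W : ℕ → Ω → 𝒲) (n : ℕ) (k : Fin K) (ω : Ω) :
    Nuisance T (𝒳 n) (Z n) :=
  F.etaHat n k (R ω) fun i => W i ω

/-- The estimated propensity scores are bounded away from zero and one. -/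
def PropensityBounded (F : CrossFit S K 𝓡) (R : Ω → 𝓡) (W : ℕ → Ω → 𝒲) (μ : Measure Ω) : Prop :=
  ∃ c : ℝ, 0 < c ∧ ∀ n k τ, ∀ᵐ ω ∂μ, ∀ᵐ w ∂S.law,
    c ≤ (F.fit R W n k ω).q τ (S.X n w) ∧ (F.fit R W n k ω).q τ (S.X n w) ≤ 1 - c

/-! In the following quantities the estimator is held fixed, and norms and expectations are taken
with respect to a new observation with distribution `S.law`; they are therefore random. -/

/-- `ψ^b(W, η̂_{-k}) - ψ^b(W, η)`. -/
def psibErr (F : CrossFit S K 𝓡) (R : Ω → 𝓡) (W : ℕ → Ω → 𝒲) (n : ℕ) (k : Fin K) (ω : Ω)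
    (w : 𝒲) : ℝ :=
  S.psib n w (F.fit R W n k ω) - S.psib n w (S.eta n)

/-- `‖ m̂_Ỹ(G_τ=1,X)_{-k} - m_Ỹ(G_τ=1,X) ‖_2`. -/
def mErr (F : CrossFit S K 𝓡) (R : Ω → 𝓡) (W : ℕ → Ω → 𝒲) (k : Fin K) (τ : T) (n : ℕ) (ω : Ω) :
    ℝ≥0∞ :=
  eLpNorm (fun w => (F.fit R W n k ω).m τ (S.X n w) - (S.eta n).m τ (S.X n w)) 2 S.law

/-- `‖ q̂_1(X)_{-k} / q̂_{G_τ}(X)_{-k} - q_1(X) / q_{G_τ}(X) ‖_2`. -/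
def ratioErr (F : CrossFit S K 𝓡) (R : Ω → 𝓡) (W : ℕ → Ω → 𝒲) (k : Fin K) (τ : T) (n : ℕ)
    (ω : Ω) : ℝ≥0∞ :=
  eLpNorm (fun w => S.ratio n (F.fit R W n k ω) τ w - S.ratio n (S.eta n) τ w) 2 S.law

/-- The rate `N^{-1/2}` for the sample size `N = K n`. -/
def rootRate (K n : ℕ) : ℝ := 1 / √((K * n : ℕ) : ℝ)

/-- The first-stage convergence conditions. -/
structure FirstStage (F : CrossFit S K 𝓡) (R : Ω → 𝓡) (W : ℕ → Ω → 𝒲) (μ : Measure Ω) :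
    Prop where
  /-- `‖ψ^b(W, η̂_{-k}) - ψ^b(W, η)‖_2 = o_p(1)` -/
  psib_two : ∀ k, LittleOp μ (fun n ω => eLpNorm (F.psibErr R W n k ω) 2 S.law) fun _ => 1
  /-- `‖ψ^b(W, η̂_{-k}) - ψ^b(W, η)‖_∞ = O_p(1)` -/
  psib_top : ∀ k, BigOpOne μ fun n ω => eLpNorm (F.psibErr R W n k ω) ∞ S.law
  /-- `E[ψ^b(W, η̂_{-k}) - ψ^b(W, η)] = o_p(N^{-1/2})` -/
  psib_mean : ∀ k, LittleOp μ (fun n ω => ‖∫ w, F.psibErr R W n k ω w ∂S.law‖ₑ) (rootRate K)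
  /-- `E[(ψ^b(W, η̂_{-k}) - ψ^b(W, η)) m̂_Ỹ(G_τ=1,X)_{-k}] = o_p(N^{-1/2})` -/
  psib_mHat : ∀ k τ, LittleOp μ
    (fun n ω => ‖∫ w, F.psibErr R W n k ω w * (F.fit R W n k ω).m τ (S.X n w) ∂S.law‖ₑ)
    (rootRate K)
  /-- `‖(ψ^b(W, η̂_{-k}) - ψ^b(W, η)) m_Ỹ(G_τ=1,X)‖_2 = o_p(1)` -/
  psib_m : ∀ k τ, LittleOp μ
    (fun n ω => eLpNorm (fun w => F.psibErr R W n k ω w * (S.eta n).m τ (S.X n w)) 2 S.law)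
    fun _ => 1
  /-- the outcome regressions converge in `L_2` -/
  m_two : ∀ k τ, LittleOp μ (F.mErr R W k τ) fun _ => 1
  /-- the propensity ratios converge in `L_2` -/
  ratio_two : ∀ k τ, LittleOp μ (F.ratioErr R W k τ) fun _ => 1
  /-- the product of the two errors is `o_p(N^{-1/2})` -/
  product : ∀ k τ, LittleOp μ (fun n ω => F.ratioErr R W k τ n ω * F.mErr R W k τ n ω)
    (rootRate K)

end CrossFit

end CrossFitting

end

namespace CrossFitting

/-! Write `N = K n`, let `A` be `N^{-1/2}` times the sum of the true scores, `E` be `N^{-1/2}` times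
the sum of the errors of the estimated scores, and `D` be the denominator of the estimator. Since
the score is affine in `θ`, there is the exact identity `√N (θ̂ - θ) - A = (A (1 - D) + E) / D`
(`sqrt_mul_thetaHat_sub_eq`). The sum `A` is bounded in probability by Chebyshev's inequality, and
`D` tends to one because `ψ^b(W, η)` has mean one and its estimation error averages out. It remains
to show `E → 0`.

Cross-fitting makes this possible without restricting the complexity of the first stage. Given the
randomization and the other folds, the summands of `E` in one fold are a fixed function of i.i.d.
observations. Their fluctuation is governed by the `L²` norm of that function, which only has to be
`o_p(1)`, and their mean contributes at most `√N` times the bias (`tendsto_whp_sum_fold`).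

The `L²` norm is small because all weights are bounded by overlap; the one product of a small factor
with an unbounded one, ratio error times residual, is handled by truncation. The bias is of second
order because the first-order terms have mean zero: residuals are orthogonal to functions of `X`
within a group, and `ψ^b(W, η)` has the same conditional mean as the weight `G_τ q_1(X) / (q_1
q_{G_τ}(X))`. What is left is the product of ratio error and regression error, and the terms in
`ψ^b` that are assumed to be `o_p(N^{-1/2})` (`dscore_eq`, `enorm_integral_dscore_le`).

For normality, the scores form a triangular array since the covariates may vary with `n`. The
regressions `m_τ(X)` are conditional expectations of the single square-integrable variable `Ỹ`, so
the squared scores are uniformly integrable (`uniformIntegrable_score`). This replaces the Lindeberg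
condition in `tendstoInDistribution_triangular`, proved with characteristic functions. Slutsky's
theorem then passes from `A` to the estimator.

Convergence in probability is expressed throughout as convergence along the filter `whp μ`, so that
the usual limit calculus applies. -/

lemma integral_sq_eq_toReal_eLpNorm_sq {α : Type*} [MeasurableSpace α] {ν : Measure α}
    {f : α → ℝ} (hf : MemLp f 2 ν) : ∫ x, f x ^ 2 ∂ν = (eLpNorm f 2 ν).toReal ^ 2 := by
  have h := hf.eLpNorm_eq_integral_rpow_norm (by norm_num) (by norm_num)
  have h0 : 0 ≤ ∫ x, f x ^ 2 ∂ν := integral_nonneg fun x => sq_nonneg _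
  rw [h]
  simp only [ENNReal.toReal_ofNat, Real.rpow_two, Real.norm_eq_abs, sq_abs]
  rw [ENNReal.toReal_ofReal (by positivity), ← Real.rpow_natCast, ← Real.rpow_mul h0]
  norm_num

lemma integral_sq_le_of_eLpNorm_le {α : Type*} [MeasurableSpace α] {ν : Measure α}
    {f : α → ℝ} (hf : AEStronglyMeasurable f ν) {ε : ℝ} (hε : 0 ≤ ε)
    (h : eLpNorm f 2 ν ≤ ENNReal.ofReal ε) : ∫ x, f x ^ 2 ∂ν ≤ ε ^ 2 := by
  have hL : MemLp f 2 ν := ⟨hf, h.trans_lt ENNReal.ofReal_lt_top⟩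
  rw [integral_sq_eq_toReal_eLpNorm_sq hL]
  exact pow_le_pow_left₀ ENNReal.toReal_nonneg (ENNReal.toReal_le_of_le_ofReal hε h) 2

/-! ### A central limit theorem for triangular arrays with i.i.d. rows -/

lemma norm_exp_mul_I_sub_taylor_le_cube {x : ℝ} (hx : |x| ≤ 1) :
    ‖Complex.exp (x * Complex.I) - (1 + x * Complex.I - (x : ℂ) ^ 2 / 2)‖ ≤ 3 * |x| ^ 3 := by
  have h := Complex.norm_exp_sub_sum_le_norm_mul_exp (x * Complex.I) 3
  have hn : ‖(x * Complex.I : ℂ)‖ = |x| := by simp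
  rw [hn] at h
  have he : Real.exp |x| ≤ 3 := by
    have := Real.exp_one_lt_d9
    have := Real.exp_le_exp.2 hx
    linarith
  have hs : ∑ m ∈ Finset.range 3, (x * Complex.I : ℂ) ^ m / m.factorial
      = 1 + x * Complex.I - (x : ℂ) ^ 2 / 2 := by
    simp [Finset.sum_range_succ, mul_pow, Nat.factorial]
    ring
  rw [hs] at h
  refine h.trans ?_
  rw [mul_comm]
  gcongr

/-- For `|x| ≤ 1` the cubic bound suffices; for `|x| ≥ 1` every term is at most a multiple of `x ^
2`. This crude bound needs only second moments and serves on the tails. -/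
lemma norm_exp_mul_I_sub_taylor_le_sq (x : ℝ) :
    ‖Complex.exp (x * Complex.I) - (1 + x * Complex.I - (x : ℂ) ^ 2 / 2)‖ ≤ 4 * x ^ 2 := by
  rcases le_total |x| 1 with hx | hx
  · refine (norm_exp_mul_I_sub_taylor_le_cube hx).trans ?_
    rw [← sq_abs x]
    nlinarith [abs_nonneg x, sq_nonneg |x|, mul_nonneg (sq_nonneg |x|) (sub_nonneg.2 hx)]
  · have h1 : ‖Complex.exp (x * Complex.I)‖ = 1 := Complex.norm_exp_ofReal_mul_I x
    have h2 : ‖(1 + x * Complex.I - (x : ℂ) ^ 2 / 2)‖ ≤ 1 + |x| + |x| ^ 2 / 2 := by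
      refine (norm_sub_le _ _).trans (add_le_add ((norm_add_le _ _).trans ?_) ?_) <;> simp
    refine (norm_sub_le _ _).trans ?_
    rw [h1, ← sq_abs x]
    nlinarith [abs_nonneg x]

/-- The integral is split at the truncation level `M`: the cubic Taylor bound is used where `|h| <
M`, the quadratic one on the tail. The linear term drops out because `h` is centered. -/
lemma norm_integral_exp_sub_le {α : Type*} [MeasurableSpace α] {ν : Measure α}
    [IsProbabilityMeasure ν] {h : α → ℝ} (hm : Measurable h) (h2 : MemLp h 2 ν)
    (h0 : ∫ x, h x ∂ν = 0) {u M : ℝ} (huM : |u| * M ≤ 1) (hM : 0 ≤ M) :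
    ‖∫ x, Complex.exp ((u * h x : ℝ) * Complex.I) ∂ν - (1 - ((u ^ 2 / 2 * ∫ x, h x ^ 2 ∂ν : ℝ) : ℂ))‖
      ≤ 3 * (|u| * M) * u ^ 2 * ∫ x, h x ^ 2 ∂ν
        + 4 * u ^ 2 * ∫ x, ({x | M ≤ |h x|}.indicator h x) ^ 2 ∂ν := by
  have hs : MeasurableSet {x | M ≤ |h x|} := measurableSet_le measurable_const hm.abs
  have i1 : Integrable h ν := h2.integrable (by norm_num)
  have i2 : Integrable (fun x => h x ^ 2) ν := h2.integrable_sq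
  have i3 : Integrable (fun x => ({x | M ≤ |h x|}.indicator h x) ^ 2) ν :=
    (h2.indicator hs).integrable_sq
  have ie : Integrable (fun x => Complex.exp ((u * h x : ℝ) * Complex.I)) ν := by
    refine Integrable.of_bound (by fun_prop) 1 (ae_of_all _ fun x => ?_)
    rw [Complex.norm_exp_ofReal_mul_I]
  have ip : Integrable (fun x => 1 + ((u * h x : ℝ) : ℂ) * Complex.I
      - ((u * h x : ℝ) : ℂ) ^ 2 / 2) ν := by
    refine ((integrable_const _).add ((i1.const_mul u).ofReal.mul_const _)).sub ?_
    have := ((i2.const_mul (u ^ 2 / 2)).ofReal (𝕜 := ℂ))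
    refine this.congr (ae_of_all _ fun x => ?_)
    simp; ring
  have hp : ∫ x, (1 + ((u * h x : ℝ) : ℂ) * Complex.I - ((u * h x : ℝ) : ℂ) ^ 2 / 2) ∂ν
      = 1 - ((u ^ 2 / 2 * ∫ x, h x ^ 2 ∂ν : ℝ) : ℂ) := by
    have e : ∀ x, (1 + ((u * h x : ℝ) : ℂ) * Complex.I - ((u * h x : ℝ) : ℂ) ^ 2 / 2)
        = (((1 - u ^ 2 / 2 * h x ^ 2 : ℝ)) : ℂ) + ((u * h x : ℝ) : ℂ) * Complex.I := by
      intro x; push_cast; ring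
    simp_rw [e]
    rw [integral_add, integral_mul_const, integral_complex_ofReal, integral_complex_ofReal,
      integral_const_mul, h0,
      integral_sub (integrable_const _) (i2.const_mul _), integral_const_mul]
    · simp
    · exact ((integrable_const _).sub (i2.const_mul _)).ofReal
    · exact (i1.const_mul u).ofReal.mul_const _
  rw [← hp, ← integral_sub ie ip, ← integral_const_mul, ← integral_const_mul,
    ← integral_add (i2.const_mul _) (i3.const_mul _)]
  refine norm_integral_le_of_norm_le ((i2.const_mul _).add (i3.const_mul _))
    (ae_of_all _ fun x => ?_)
  by_cases hx : M ≤ |h x|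
  · have := norm_exp_mul_I_sub_taylor_le_sq (u * h x)
    simp only [Set.indicator, Set.mem_ofPred_eq, hx, if_true]
    refine this.trans ?_
    have : 0 ≤ 3 * (|u| * M) * u ^ 2 * h x ^ 2 := by positivity
    nlinarith
  · simp only [Set.indicator, Set.mem_ofPred_eq, hx, if_false]
    push Not at hx
    have hux : |u * h x| ≤ |u| * M := by
      rw [abs_mul]; gcongr
    refine (norm_exp_mul_I_sub_taylor_le_cube (hux.trans huM)).trans ?_
    have : |u * h x| ^ 3 ≤ (|u| * M) * (u ^ 2 * h x ^ 2) := by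
      rw [pow_succ', sq_abs, mul_pow]
      gcongr
    nlinarith

/-- The characteristic function of a normalized row sum converges. -/
lemma tendsto_integral_exp_pow {α : Type*} [MeasurableSpace α] {ν : Measure α}
    [IsProbabilityMeasure ν] {s : ℕ → α → ℝ} (hm : ∀ n, Measurable (s n))
    (hui : UniformIntegrable s 2 ν) (h0 : ∀ n, ∫ x, s n x ∂ν = 0) {v : ℝ}
    (hv : Tendsto (fun n => ∫ x, s n x ^ 2 ∂ν) atTop (𝓝 v)) (t : ℝ) :
    Tendsto (fun n : ℕ =>
      (∫ x, Complex.exp ((((√(n : ℝ))⁻¹ * t) * s n x : ℝ) * Complex.I) ∂ν) ^ n) atTop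
      (𝓝 (Complex.exp ((-(t ^ 2 * v / 2) : ℝ)))) := by
  set z : ℕ → ℂ := fun n => ∫ x, Complex.exp ((((√(n : ℝ))⁻¹ * t) * s n x : ℝ) * Complex.I) ∂ν
  set V : ℕ → ℝ := fun n => ∫ x, s n x ^ 2 ∂ν
  have hrate : Tendsto (fun n : ℕ => (√(n : ℝ))⁻¹) atTop (𝓝 0) :=
    tendsto_inv_atTop_zero.comp (Real.tendsto_sqrt_atTop.comp tendsto_natCast_atTop_atTop)
  have key : Tendsto (fun n : ℕ => n * (z n - (1 - ((((√(n : ℝ))⁻¹ * t) ^ 2 / 2 * V n : ℝ) : ℂ))))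
      atTop (𝓝 0) := by
    rw [Metric.tendsto_atTop']
    intro ε hε
    -- Since `n (t / √n) ^ 2 = t ^ 2`, the tail contributes at most `4 t ^ 2 δ ^ 2`. Uniform
    -- integrability turns `δ` into a level `M` valid for all `n`; with `M` fixed, the remaining
    -- cubic term is of order `M / √n`.
    obtain ⟨δ, hδ, hδε⟩ : ∃ δ : ℝ, 0 < δ ∧ 4 * t ^ 2 * δ ^ 2 < ε / 2 := by
      have : Tendsto (fun δ : ℝ => 4 * t ^ 2 * δ ^ 2) (𝓝[>] 0) (𝓝 0) := by
        have h : Continuous fun δ : ℝ => 4 * t ^ 2 * δ ^ 2 := by fun_prop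
        simpa using (h.tendsto 0).mono_left nhdsWithin_le_nhds
      obtain ⟨δ, h1, h2⟩ := ((this.eventually_lt_const (half_pos hε)).and
        self_mem_nhdsWithin).exists
      exact ⟨δ, h2, h1⟩
    obtain ⟨M, hM⟩ := hui.spec (by norm_num) (by norm_num) hδ
    have hu : Tendsto (fun n : ℕ => |(√(n : ℝ))⁻¹ * t| * (M : ℝ)) atTop (𝓝 0) := by
      simpa using ((hrate.mul_const t).abs.mul_const (M : ℝ))
    have hb : Tendsto (fun n : ℕ => 3 * (|(√(n : ℝ))⁻¹ * t| * (M : ℝ)) * t ^ 2 * V n) atTop (𝓝 0) := by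
      simpa using (((hu.const_mul 3).mul_const (t ^ 2)).mul hv)
    have hev : ∀ᶠ n : ℕ in atTop,
        dist ((n : ℂ) * (z n - (1 - ((((√(n : ℝ))⁻¹ * t) ^ 2 / 2 * V n : ℝ) : ℂ)))) 0 < ε := by
      filter_upwards [hu.eventually_le_const one_pos, hb.eventually_lt_const (half_pos hε),
        eventually_gt_atTop 0] with n h1 h2 hn
      have h3 := norm_integral_exp_sub_le (hm n) (hui.memLp n) (h0 n) h1 M.2
      have hset : {x | (M : ℝ) ≤ |s n x|} = {x | M ≤ ‖s n x‖₊} := by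
        ext x
        simp [← NNReal.coe_le_coe]
      have h4 : ∫ x, ({x | (M : ℝ) ≤ |s n x|}.indicator (s n) x) ^ 2 ∂ν ≤ δ ^ 2 := by
        rw [hset]
        refine integral_sq_le_of_eLpNorm_le ?_ hδ.le (hM n)
        refine ((hm n).indicator ?_).aestronglyMeasurable
        exact measurableSet_le measurable_const (hm n).nnnorm
      have hnp : (0 : ℝ) < n := by exact_mod_cast hn
      have hsq : (n : ℝ) * ((√(n : ℝ))⁻¹ * t) ^ 2 = t ^ 2 := by
        rw [mul_pow, inv_pow, Real.sq_sqrt hnp.le]; field_simp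
      rw [dist_zero_right, norm_mul, Complex.norm_natCast]
      calc (n : ℝ) * _ ≤ n * _ := mul_le_mul_of_nonneg_left h3 hnp.le
        _ = 3 * (|(√(n : ℝ))⁻¹ * t| * (M : ℝ)) * (n * ((√(n : ℝ))⁻¹ * t) ^ 2) * V n
          + 4 * (n * ((√(n : ℝ))⁻¹ * t) ^ 2)
            * ∫ x, ({x | (M : ℝ) ≤ |s n x|}.indicator (s n) x) ^ 2 ∂ν := by
              simp only [V]; ring
        _ ≤ 3 * (|(√(n : ℝ))⁻¹ * t| * (M : ℝ)) * t ^ 2 * V n + 4 * t ^ 2 * δ ^ 2 := by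
              rw [hsq]; gcongr
        _ < ε := by linarith
    obtain ⟨N, hN⟩ := eventually_atTop.1 hev
    exact ⟨N, fun n hn => hN n hn.le⟩
  -- This is the hypothesis of `(1 + w_n / n) ^ n → exp w`, where `w_n → w`.
  have h1 : Tendsto (fun n : ℕ => (n : ℂ) * (z n - 1)) atTop (𝓝 ((-(t ^ 2 * v / 2) : ℝ) : ℂ)) := by
    have hv' : Tendsto (fun n => ((-(t ^ 2 * V n / 2) : ℝ) : ℂ)) atTop
        (𝓝 ((-(t ^ 2 * v / 2) : ℝ) : ℂ)) :=
      (Complex.continuous_ofReal.tendsto _).comp (((hv.const_mul (t ^ 2)).div_const 2).neg)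
    have := key.add hv'
    rw [zero_add] at this
    refine this.congr' ?_
    filter_upwards [eventually_gt_atTop 0] with n hn
    have hnp : (0 : ℝ) < n := by exact_mod_cast hn
    have hsq : (n : ℝ) * ((√(n : ℝ))⁻¹ * t) ^ 2 = t ^ 2 := by
      rw [mul_pow, inv_pow, Real.sq_sqrt hnp.le]; field_simp
    rw [← hsq]
    push_cast
    ring
  have := Complex.tendsto_one_add_pow_exp_of_tendsto h1
  refine this.congr fun n => ?_
  simp [z]

/-- **Central limit theorem** for triangular arrays whose rows are functions of one i.i.d. sequence
and whose squares are uniformly integrable. -/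
theorem tendstoInDistribution_triangular {Ω α : Type*} [MeasurableSpace Ω] [MeasurableSpace α]
    {μ : Measure Ω} [IsProbabilityMeasure μ] {ν : Measure α} [IsProbabilityMeasure ν]
    {W : ℕ → Ω → α} (hW : ∀ i, Measurable (W i)) (hlaw : ∀ i, μ.map (W i) = ν)
    (hindep : iIndepFun W μ) {s : ℕ → α → ℝ} (hm : ∀ n, Measurable (s n))
    (hui : UniformIntegrable s 2 ν) (h0 : ∀ n, ∫ x, s n x ∂ν = 0) {v : ℝ≥0}
    (hv : Tendsto (fun n => ∫ x, s n x ^ 2 ∂ν) atTop (𝓝 (v : ℝ))) :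
    TendstoInDistribution
      (fun (n : ℕ) ω => (√(n : ℝ))⁻¹ * ∑ i ∈ Finset.range n, s n (W i ω)) atTop
      (id : ℝ → ℝ) (fun _ => μ) (gaussianReal 0 v) := by
  have hmeas : ∀ n i, Measurable fun ω => s n (W i ω) := fun n i => (hm n).comp (hW i)
  refine ⟨fun n => (Measurable.const_mul (Finset.measurable_fun_sum _ fun i _ => hmeas n i)
    _).aemeasurable, by fun_prop, ?_⟩
  refine ProbabilityMeasure.tendsto_iff_tendsto_charFun.2 fun t => ?_
  have hlim := tendsto_integral_exp_pow hm hui h0 hv t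
  have hg : charFun ((gaussianReal 0 v).map id) t = Complex.exp ((-(t ^ 2 * v / 2) : ℝ)) := by
    rw [Measure.map_id, charFun_gaussianReal]
    congr 1
    push_cast
    ring
  simp only [ProbabilityMeasure.coe_mk]
  rw [hg]
  refine hlim.congr fun n => ?_
  have hind : iIndepFun (fun i ω => s n (W i ω)) μ := hindep.comp (fun _ => s n) fun _ => hm n
  rw [charFun_map_mul_comp (by
      exact (Finset.measurable_fun_sum _ fun i _ => hmeas n i).aemeasurable),
    (hind.restrict _).charFun_map_fun_finsetSum_eq_prod (fun i _ => (hmeas n i).aemeasurable)]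
  have e : ∀ i, charFun (μ.map fun ω => s n (W i ω)) ((√(n : ℝ))⁻¹ * t)
      = ∫ x, Complex.exp ((((√(n : ℝ))⁻¹ * t) * s n x : ℝ) * Complex.I) ∂ν := by
    intro i
    rw [charFun_apply_real, integral_map (hmeas n i).aemeasurable (by fun_prop), ← hlaw i,
      integral_map (hW i).aemeasurable (by have := hm n; fun_prop)]
    push_cast
    rfl
  simp [e]

/-! ### Convergence in probability as convergence along a filter -/

/-- The filter of events `s n` whose probability tends to one. A sequence of random variables
converges to a constant in probability if and only if it converges along this filter. -/
def whp {Ω : Type*} [MeasurableSpace Ω] (μ : Measure Ω) : Filter (ℕ × Ω) where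
  sets := {s | Tendsto (fun n => μ {ω | (n, ω) ∉ s}) atTop (𝓝 0)}
  univ_sets := by simp
  sets_of_superset {s t} hs hst := by
    refine tendsto_of_tendsto_of_tendsto_of_le_of_le tendsto_const_nhds hs
      (fun _ => bot_le) fun n => measure_mono fun ω hω h => hω (hst h)
  inter_sets {s t} hs ht := by
    have h := Tendsto.add hs ht
    rw [add_zero] at h
    refine tendsto_of_tendsto_of_tendsto_of_le_of_le tendsto_const_nhds h
      (fun _ => bot_le) fun n => (measure_mono fun ω hω => ?_).trans (measure_union_le _ _)
    by_contra hc
    simp only [Set.mem_union, Set.mem_ofPred_eq, not_or, not_not] at hc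
    exact hω hc

section Whp

variable {Ω : Type*} [MeasurableSpace Ω] {μ : Measure Ω}

lemma eventually_whp {P : ℕ × Ω → Prop} :
    (∀ᶠ p in whp μ, P p) ↔ Tendsto (fun n => μ {ω | ¬ P (n, ω)}) atTop (𝓝 0) := Iff.rfl

lemma eventually_whp_of_ae {P : ℕ × Ω → Prop} (h : ∀ n, ∀ᵐ ω ∂μ, P (n, ω)) :
    ∀ᶠ p in whp μ, P p := by
  rw [eventually_whp]
  have : (fun n => μ {ω | ¬ P (n, ω)}) = fun _ => 0 := funext fun n => h n
  rw [this]
  exact tendsto_const_nhds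

lemma tendsto_fst_whp : Tendsto Prod.fst (whp μ) atTop := by
  intro s hs
  obtain ⟨N, hN⟩ := mem_atTop_sets.1 hs
  refine tendsto_const_nhds.congr' ?_
  filter_upwards [eventually_ge_atTop N] with n hn
  have : {ω : Ω | (n, ω) ∉ Prod.fst ⁻¹' s} = ∅ := by
    ext ω
    simpa using hN n hn
  rw [this, measure_empty]

/-- The form in which probability bounds enter: for each `η` it suffices to bound the failure of `P`
by `η` on a good event `Q` whose probability tends to one. The event `Q` may depend on `η`. -/
lemma eventually_whp_of_forall_pos {P : ℕ × Ω → Prop}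
    (h : ∀ η : ℝ≥0, 0 < η → ∃ Q : ℕ × Ω → Prop, (∀ᶠ p in whp μ, Q p) ∧
      ∀ᶠ n in atTop, μ {ω | Q (n, ω) ∧ ¬ P (n, ω)} ≤ η) : ∀ᶠ p in whp μ, P p := by
  rw [eventually_whp, ENNReal.tendsto_nhds_zero]
  intro ε hε
  obtain ⟨η, hη, hηε⟩ := ENNReal.lt_iff_exists_nnreal_btwn.1 (ENNReal.half_pos hε.ne')
  obtain ⟨Q, hQ, hn⟩ := h η (by exact_mod_cast hη)
  filter_upwards [hn, ENNReal.tendsto_nhds_zero.1 (eventually_whp.1 hQ) η hη] with n h1 h2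
  calc μ {ω | ¬ P (n, ω)} ≤ μ ({ω | Q (n, ω) ∧ ¬ P (n, ω)} ∪ {ω | ¬ Q (n, ω)}) :=
        measure_mono fun ω hω => by
          by_cases hq : Q (n, ω)
          · exact Or.inl ⟨hq, hω⟩
          · exact Or.inr hq
    _ ≤ η + η := (measure_union_le _ _).trans (add_le_add h1 h2)
    _ ≤ ε / 2 + ε / 2 := add_le_add hηε.le hηε.le
    _ = ε := ENNReal.add_halves ε

lemma LittleOp.tendsto_whp {f : ℕ → Ω → ℝ≥0∞} (h : LittleOp μ f fun _ => 1) :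
    Tendsto (fun p : ℕ × Ω => f p.1 p.2) (whp μ) (𝓝 0) := by
  rw [ENNReal.tendsto_nhds_zero]
  intro ε hε
  obtain ⟨η, hη, hηε⟩ := ENNReal.lt_iff_exists_nnreal_btwn.1 hε
  have := h η (by exact_mod_cast hη)
  refine tendsto_of_tendsto_of_tendsto_of_le_of_le tendsto_const_nhds this
      (fun _ => bot_le) fun n => measure_mono fun ω hω => ?_
  simp only [Set.mem_ofPred_eq, not_le, mul_one, ENNReal.ofReal_coe_nnreal] at hω ⊢
  exact (hηε.trans hω).le

lemma LittleOp.tendsto_whp_rootRate {K : ℕ} (hK : 0 < K) {f : ℕ → Ω → ℝ≥0∞}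
    (h : LittleOp μ f (CrossFit.rootRate K)) :
    Tendsto (fun p : ℕ × Ω => ENNReal.ofReal √((K * p.1 : ℕ) : ℝ) * f p.1 p.2) (whp μ) (𝓝 0) := by
  refine LittleOp.tendsto_whp (f := fun n ω => ENNReal.ofReal √((K * n : ℕ) : ℝ) * f n ω) ?_
  intro ε hε
  refine (h ε hε).congr' ?_
  filter_upwards [eventually_gt_atTop 0] with n hn
  have hN : (0 : ℝ) < √((K * n : ℕ) : ℝ) := Real.sqrt_pos.2 (by exact_mod_cast Nat.mul_pos hK hn)
  congr 1
  ext ω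
  simp only [Set.mem_ofPred_eq]
  rw [CrossFit.rootRate, mul_one_div, ENNReal.ofReal_div_of_pos hN, mul_one,
    ENNReal.div_le_iff_le_mul (Or.inl (ENNReal.ofReal_pos.2 hN).ne') (Or.inl ENNReal.ofReal_ne_top),
    mul_comm (f n ω)]

lemma tendstoInMeasure_zero_of_tendsto_whp {f : ℕ → Ω → ℝ}
    (h : Tendsto (fun p : ℕ × Ω => f p.1 p.2) (whp μ) (𝓝 0)) :
    TendstoInMeasure μ f atTop fun _ => 0 := by
  rw [tendstoInMeasure_iff_norm]
  intro ε hε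
  have h1 : ∀ᶠ p in whp μ, dist (f p.1 p.2) 0 < ε := h.eventually (Metric.ball_mem_nhds 0 hε)
  refine (eventually_whp.1 h1).congr fun n => ?_
  simp

/-- Where `M * g ≤ ε`, the product can exceed `ε` only if `f > M`, which has probability at most
`η`. -/
lemma tendsto_whp_mul_of_bigOpOne {f g : ℕ → Ω → ℝ≥0∞} (hf : BigOpOne μ f)
    (hg : Tendsto (fun p : ℕ × Ω => g p.1 p.2) (whp μ) (𝓝 0)) :
    Tendsto (fun p : ℕ × Ω => f p.1 p.2 * g p.1 p.2) (whp μ) (𝓝 0) := by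
  rw [ENNReal.tendsto_nhds_zero]
  intro ε hε
  refine eventually_whp_of_forall_pos fun η hη => ?_
  obtain ⟨M, hM⟩ := hf η (by exact_mod_cast hη)
  have h0 : Tendsto (fun p : ℕ × Ω => (M : ℝ≥0∞) * g p.1 p.2) (whp μ) (𝓝 0) := by
    simpa using ENNReal.Tendsto.const_mul hg (Or.inr (ENNReal.coe_ne_top (r := M)))
  refine ⟨_, ENNReal.tendsto_nhds_zero.1 h0 ε hε, ?_⟩
  filter_upwards [hM] with n hn
  refine (measure_mono fun ω hω => ?_).trans hn
  simp only [Set.mem_ofPred_eq, not_le] at hω ⊢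
  by_contra hc
  push Not at hc
  exact absurd (hω.2.trans_le ((mul_le_mul_left hc _).trans hω.1)) (lt_irrefl _)

lemma BigOpOne.eventually_lt_top {f : ℕ → Ω → ℝ≥0∞} (hf : BigOpOne μ f) :
    ∀ᶠ p in whp μ, f p.1 p.2 < ∞ := by
  refine eventually_whp_of_forall_pos fun η hη => ?_
  obtain ⟨M, hM⟩ := hf η (by exact_mod_cast hη)
  refine ⟨fun _ => True, Eventually.of_forall fun _ => trivial, ?_⟩
  filter_upwards [hM] with n hn
  refine (measure_mono fun ω hω => ?_).trans hn
  simp only [Set.mem_ofPred_eq, true_and, not_lt, top_le_iff] at hω ⊢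
  rw [hω]
  exact ENNReal.coe_lt_top

lemma tendsto_zero_iff_enorm {α : Type*} {l : Filter α} {f : α → ℝ} :
    Tendsto f l (𝓝 0) ↔ Tendsto (fun a => ‖f a‖ₑ) l (𝓝 0) := by
  rw [tendsto_zero_iff_norm_tendsto_zero, ← ENNReal.tendsto_toReal_zero_iff (fun a => enorm_ne_top)]
  simp

lemma tendsto_whp_mul_of_bigOpOne_real {f g : ℕ → Ω → ℝ} (hf : BigOpOne μ fun n ω => ‖f n ω‖ₑ)
    (hg : Tendsto (fun p : ℕ × Ω => g p.1 p.2) (whp μ) (𝓝 0)) :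
    Tendsto (fun p : ℕ × Ω => f p.1 p.2 * g p.1 p.2) (whp μ) (𝓝 0) := by
  rw [tendsto_zero_iff_enorm] at hg ⊢
  simp only [enorm_mul]
  exact tendsto_whp_mul_of_bigOpOne (f := fun n ω => ‖f n ω‖ₑ) (g := fun n ω => ‖g n ω‖ₑ) hf hg

end Whp

/-! ### Chebyshev's inequality conditionally on the training sample -/

lemma map_sample_eq_pi {𝒲 Ω : Type*} [MeasurableSpace 𝒲] [MeasurableSpace Ω] {μ : Measure Ω}
    {ν : Measure 𝒲} {W : ℕ → Ω → 𝒲} (hW : ∀ i, Measurable (W i)) (hlaw : ∀ i, μ.map (W i) = ν)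
    (hindep : iIndepFun W μ) (N : ℕ) :
    μ.map (fun ω (i : Fin N) => W i ω) = Measure.pi fun _ => ν := by
  have h0 : iIndepFun (fun i : Fin N => W (i : ℕ)) μ := hindep.precomp Fin.val_injective
  have h := iIndepFun.map_fun_eq_pi_map (f := fun i : Fin N => W (i : ℕ))
    (fun i => (hW i).aemeasurable) h0
  simpa [hlaw] using h

lemma map_device_sample_eq_prod {𝒲 𝓡 Ω : Type*} [MeasurableSpace 𝒲] [MeasurableSpace 𝓡]
    [MeasurableSpace Ω] {μ : Measure Ω} [IsProbabilityMeasure μ] {ν : Measure 𝒲} {W : ℕ → Ω → 𝒲}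
    {R : Ω → 𝓡} (hW : ∀ i, Measurable (W i)) (hlaw : ∀ i, μ.map (W i) = ν)
    (hindep : iIndepFun W μ) (hR : Measurable R)
    (hRW : IndepFun R (fun ω i => W i ω) μ) (N : ℕ) :
    μ.map (fun ω => (R ω, fun i : Fin N => W i ω))
      = (μ.map R).prod (Measure.pi fun _ : Fin N => ν) := by
  have h : IndepFun R (fun ω (i : Fin N) => W i ω) μ :=
    IndepFun.comp (φ := id) (ψ := fun (w : ℕ → 𝒲) (i : Fin N) => w i) hRW measurable_id
      (measurable_pi_lambda _ fun i => measurable_pi_apply _)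
  rw [← map_sample_eq_pi hW hlaw hindep N]
  exact h.map_prod_eq_prod_map_map hR.aemeasurable
    (measurable_pi_lambda _ fun i : Fin N => hW i).aemeasurable

section Chebyshev

variable {𝒲 : Type*} [MeasurableSpace 𝒲] {ν : Measure 𝒲} [IsProbabilityMeasure ν]

/-- The variance of a sum of independent terms is the sum of the variances, and each variance is at
most the second moment, hence at most `γ ^ 2`. -/
lemma pi_chebyshev {ι : Type*} [Fintype ι] {g : 𝒲 → ℝ} (hg : Measurable g) {γ ε : ℝ}
    (hγ : 0 ≤ γ) (hε : 0 < ε) (h2 : eLpNorm g 2 ν ≤ ENNReal.ofReal γ) :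
    Measure.pi (fun _ : ι => ν) {v | ε ≤ |∑ i, g (v i) - Fintype.card ι * ∫ x, g x ∂ν|}
      ≤ ENNReal.ofReal (Fintype.card ι * γ ^ 2 / ε ^ 2) := by
  have hL : MemLp g 2 ν := ⟨hg.aestronglyMeasurable, h2.trans_lt ENNReal.ofReal_lt_top⟩
  have hLi : ∀ i, MemLp (fun v : ι → 𝒲 => g (v i)) 2 (Measure.pi fun _ : ι => ν) := fun i =>
    hL.comp_measurePreserving (measurePreserving_eval (fun _ : ι => ν) i)
  have hsum : MemLp (∑ i, fun v : ι → 𝒲 => g (v i)) 2 (Measure.pi fun _ : ι => ν) :=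
    memLp_finsetSum' _ fun i _ => hLi i
  have hmean : ∫ v, (∑ i, fun v : ι → 𝒲 => g (v i)) v ∂(Measure.pi fun _ : ι => ν)
      = Fintype.card ι * ∫ x, g x ∂ν := by
    simp only [Finset.sum_apply]
    rw [integral_finsetSum _ fun i _ => (hLi i).integrable (by norm_num)]
    have : ∀ i, ∫ v : ι → 𝒲, g (v i) ∂(Measure.pi fun _ : ι => ν) = ∫ x, g x ∂ν := fun i =>
      integral_comp_eval (μ := fun _ : ι => ν) (i := i) hg.aestronglyMeasurable
    simp [this]
  have h := meas_ge_le_variance_div_sq hsum hε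
  rw [hmean, variance_sum_pi fun _ => hL] at h
  simp only [Finset.sum_apply] at h
  refine h.trans (ENNReal.ofReal_le_ofReal ?_)
  have hv : Var[g; ν] ≤ γ ^ 2 :=
    (variance_le_expectation_sq hg.aestronglyMeasurable).trans
      (integral_sq_le_of_eLpNorm_le hg.aestronglyMeasurable hγ h2)
  simp only [Finset.sum_const, Finset.card_univ, nsmul_eq_mul]
  gcongr

lemma measurable_eLpNorm_two {β : Type*} [MeasurableSpace β] {h : β → 𝒲 → ℝ}
    (hh : Measurable fun p : β × 𝒲 => h p.1 p.2) :
    Measurable fun b => eLpNorm (h b) 2 ν := by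
  have : (fun b => eLpNorm (h b) 2 ν)
      = fun b => (∫⁻ x, ‖h b x‖ₑ ^ (2 : ℝ) ∂ν) ^ (1 / (2 : ℝ)) := by
    ext b
    rw [eLpNorm_eq_lintegral_rpow_enorm_toReal (by norm_num) (by norm_num)]
    simp
  rw [this]
  exact (Measurable.lintegral_prod_right' (f := fun p : β × 𝒲 => ‖h p.1 p.2‖ₑ ^ (2 : ℝ))
    (hh.enorm.pow_const _)).pow_const _

lemma measurable_integral_param {β : Type*} [MeasurableSpace β] {h : β → 𝒲 → ℝ}
    (hh : Measurable fun p : β × 𝒲 => h p.1 p.2) : Measurable fun b => ∫ x, h b x ∂ν :=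
  (hh.stronglyMeasurable.integral_prod_right' (ν := ν)).measurable

/-- Chebyshev's inequality for the observations in `p`, when the summand is a function of the
observations outside `p`. -/
lemma pi_chebyshev_of_dependsOn {ι : Type*} [Fintype ι] (p : ι → Prop) [DecidablePred p]
    {h : (ι → 𝒲) → 𝒲 → ℝ} (hh : Measurable fun q : (ι → 𝒲) × 𝒲 => h q.1 q.2)
    (hdep : DependsOn h {i | ¬ p i}) {γ ε : ℝ} (hγ : 0 ≤ γ) (hε : 0 < ε) :
    Measure.pi (fun _ : ι => ν) {w | eLpNorm (h w) 2 ν ≤ ENNReal.ofReal γ ∧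
        ε ≤ |∑ i with p i, h w (w i) - (Finset.univ.filter p).card * ∫ x, h w x ∂ν|}
      ≤ ENNReal.ofReal ((Finset.univ.filter p).card * γ ^ 2 / ε ^ 2) := by
  set A : Set (ι → 𝒲) := {w | eLpNorm (h w) 2 ν ≤ ENNReal.ofReal γ ∧
        ε ≤ |∑ i with p i, h w (w i) - (Finset.univ.filter p).card * ∫ x, h w x ∂ν|} with hA
  have hAm : MeasurableSet A := by
    have hm : Measurable fun w : ι → 𝒲 => ∑ i with p i, h w (w i)
        - (Finset.univ.filter p).card * ∫ x, h w x ∂ν := by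
      refine Measurable.sub ?_ ((measurable_integral_param hh).const_mul _)
      exact Finset.measurable_fun_sum _ fun i _ =>
        hh.comp (measurable_id.prodMk (measurable_pi_apply i))
    exact (measurableSet_le (measurable_eLpNorm_two hh) measurable_const).inter
      (measurableSet_le measurable_const hm.abs)
  -- By Fubini, the coordinates `y` outside `p` are fixed and the section in the coordinates `x`
  -- inside `p` is measured.
  set e := MeasurableEquiv.piEquivPiSubtypeProd (fun _ : ι => 𝒲) p with he
  have hmp := (measurePreserving_piEquivPiSubtypeProd (fun _ : ι => ν) p).symm
  rw [← hmp.measure_preimage hAm.nullMeasurableSet,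
    Measure.prod_apply_symm (hmp.measurable hAm)]
  have hcard : (Finset.univ.filter p).card = Fintype.card (Subtype p) :=
    (Fintype.card_subtype p).symm
  calc _ ≤ ∫⁻ _ : ({i // ¬ p i} → 𝒲), ENNReal.ofReal
          ((Finset.univ.filter p).card * γ ^ 2 / ε ^ 2) ∂(Measure.pi fun _ => ν) := by
        refine lintegral_mono fun y => ?_
        -- Along a section `h` is one fixed function, represented by any point `x₀` of the section.
        -- Membership of that point also supplies the `L²` bound, so Chebyshev's inequality applies;
        -- an empty section costs nothing.
        rcases Set.eq_empty_or_nonempty ((fun x => (x, y)) ⁻¹' (e.symm ⁻¹' A)) with h0 | ⟨x₀, hx₀⟩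
        · simp only [e] at h0
          rw [h0, measure_empty]
          exact bot_le
        · have hg : ∀ x, h (e.symm (x, y)) = h (e.symm (x₀, y)) := fun x => hdep fun i hi => by
            have hi' : ¬ p i := hi
            simp [e, MeasurableEquiv.piEquivPiSubtypeProd, Equiv.piEquivPiSubtypeProd, hi']
          have hsum : ∀ x, ∑ i with p i, h (e.symm (x₀, y)) ((e.symm (x, y)) i)
              = ∑ i : Subtype p, h (e.symm (x₀, y)) (x i) := fun x => by
            rw [← Finset.sum_subtype_eq_sum_filter, Finset.subtype_univ]
            refine Finset.sum_congr rfl fun i _ => ?_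
            simp [e, MeasurableEquiv.piEquivPiSubtypeProd, Equiv.piEquivPiSubtypeProd, i.2]
          have hx₀' : e.symm (x₀, y) ∈ A := hx₀
          have hgm : Measurable (h (e.symm (x₀, y))) := hh.comp measurable_prodMk_left
          rw [hcard]
          refine le_trans (measure_mono ?_) (pi_chebyshev (ι := Subtype p) hgm hγ hε hx₀'.1)
          intro x hx
          have hx' : e.symm (x, y) ∈ A := hx
          have := hx'.2
          rw [hg x, hsum x, hcard] at this
          exact this
    _ ≤ _ := by simp

variable {𝓡 Ω : Type*} [MeasurableSpace 𝓡] [MeasurableSpace Ω] {μ : Measure Ω}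
  {W : ℕ → Ω → 𝒲} {R : Ω → 𝓡}

/-- Chebyshev's inequality for the observations of one fold, when the summand is a function of the
observations of the other folds and of an external randomization device. -/
lemma chebyshev_fold [IsProbabilityMeasure μ] (hW : ∀ i, Measurable (W i))
    (hlaw : ∀ i, μ.map (W i) = ν) (hindep : iIndepFun W μ) (hR : Measurable R) (hRW : IndepFun R (fun ω i => W i ω) μ)
    {N n K : ℕ} {split : 𝓡 → Fin N → Fin K} (hsplit : Measurable split) (k : Fin K)
    (hcard : ∀ r, (Finset.univ.filter fun i => split r i = k).card = n)
    {h : 𝓡 → (Fin N → 𝒲) → 𝒲 → ℝ}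
    (hh : Measurable fun q : 𝓡 × (Fin N → 𝒲) × 𝒲 => h q.1 q.2.1 q.2.2)
    (hdep : ∀ r, DependsOn (h r) {i | split r i ≠ k}) {γ ε : ℝ} (hγ : 0 ≤ γ) (hε : 0 < ε) :
    μ {ω | eLpNorm (h (R ω) fun i => W i ω) 2 ν ≤ ENNReal.ofReal γ ∧
        ε ≤ |∑ i with split (R ω) i = k, h (R ω) (fun i => W i ω) (W i ω)
          - n * ∫ x, h (R ω) (fun i => W i ω) x ∂ν|}
      ≤ ENNReal.ofReal (n * γ ^ 2 / ε ^ 2) := by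
  set B : Set (𝓡 × (Fin N → 𝒲)) := {q | eLpNorm (h q.1 q.2) 2 ν ≤ ENNReal.ofReal γ ∧
        ε ≤ |∑ i with split q.1 i = k, h q.1 q.2 (q.2 i) - n * ∫ x, h q.1 q.2 x ∂ν|} with hB
  have hh' : Measurable fun q : (𝓡 × (Fin N → 𝒲)) × 𝒲 => h q.1.1 q.1.2 q.2 :=
    hh.comp (measurable_fst.fst.prodMk (measurable_fst.snd.prodMk measurable_snd))
  have hBm : MeasurableSet B := by
    have hm : Measurable fun q : 𝓡 × (Fin N → 𝒲) => ∑ i with split q.1 i = k, h q.1 q.2 (q.2 i)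
        - n * ∫ x, h q.1 q.2 x ∂ν := by
      refine Measurable.sub ?_ ((measurable_integral_param
        (h := fun q : 𝓡 × (Fin N → 𝒲) => h q.1 q.2) hh').const_mul _)
      -- The index set of the sum is random, so the sum is rewritten over all indices with
      -- measurable conditions on the split.
      simp only [Finset.sum_filter]
      refine Finset.measurable_fun_sum _ fun i _ => Measurable.ite ?_ ?_ measurable_const
      · exact (((measurable_pi_apply i).comp hsplit).comp measurable_fst)
          (measurableSet_singleton k)
      · exact hh'.comp (measurable_id.prodMk ((measurable_pi_apply i).comp measurable_snd))
    exact (measurableSet_le (measurable_eLpNorm_two (h := fun q : 𝓡 × (Fin N → 𝒲) => h q.1 q.2)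
      hh') measurable_const).inter (measurableSet_le measurable_const hm.abs)
  have hmeas : Measurable fun ω => (R ω, fun i : Fin N => W i ω) :=
    hR.prodMk (measurable_pi_lambda _ fun i => hW i)
  have : IsProbabilityMeasure (μ.map R) := Measure.isProbabilityMeasure_map hR.aemeasurable
  change μ ((fun ω => (R ω, fun i : Fin N => W i ω)) ⁻¹' B) ≤ _
  rw [← Measure.map_apply hmeas hBm, map_device_sample_eq_prod hW hlaw hindep hR hRW,
    Measure.prod_apply hBm]
  calc _ ≤ ∫⁻ _ : 𝓡, ENNReal.ofReal (n * γ ^ 2 / ε ^ 2) ∂(μ.map R) := by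
        refine lintegral_mono fun r => ?_
        have := pi_chebyshev_of_dependsOn (ν := ν) (fun i => split r i = k) (h := h r)
          (hh.comp measurable_prodMk_left) (hdep r) hγ hε
        rw [hcard r] at this
        exact this
    _ ≤ _ := by simp

/-- A normalized sum over one fold is negligible if the summand, a function of the observations of
the other folds, is small in `L²` and has a mean of smaller order than `N^{-1/2}`. -/
lemma tendsto_whp_sum_fold [IsProbabilityMeasure μ] (hW : ∀ i, Measurable (W i))
    (hlaw : ∀ i, μ.map (W i) = ν) (hindep : iIndepFun W μ) (hR : Measurable R) (hRW : IndepFun R (fun ω i => W i ω) μ)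
    {K : ℕ} (hK : 0 < K) {split : ∀ n, 𝓡 → Fin (K * n) → Fin K}
    (hsplit : ∀ n, Measurable (split n)) (k : Fin K)
    (hcard : ∀ n r, (Finset.univ.filter fun i => split n r i = k).card = n)
    {h : ∀ n, 𝓡 → (Fin (K * n) → 𝒲) → 𝒲 → ℝ}
    (hh : ∀ n, Measurable fun q : 𝓡 × (Fin (K * n) → 𝒲) × 𝒲 => h n q.1 q.2.1 q.2.2)
    (hdep : ∀ n r, DependsOn (h n r) {i | split n r i ≠ k})
    (h2 : Tendsto (fun p : ℕ × Ω => eLpNorm (h p.1 (R p.2) fun i => W i p.2) 2 ν) (whp μ) (𝓝 0))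
    (h1 : Tendsto (fun p : ℕ × Ω => ENNReal.ofReal √((K * p.1 : ℕ) : ℝ)
      * ‖∫ x, h p.1 (R p.2) (fun i => W i p.2) x ∂ν‖ₑ) (whp μ) (𝓝 0)) :
    Tendsto (fun p : ℕ × Ω => 1 / √((K * p.1 : ℕ) : ℝ)
      * ∑ i with split p.1 (R p.2) i = k, h p.1 (R p.2) (fun i => W i p.2) (W i p.2))
      (whp μ) (𝓝 0) := by
  set I : ℕ × Ω → ℝ := fun p => ∫ x, h p.1 (R p.2) (fun i => W i p.2) x ∂ν with hI
  set Z : ℕ × Ω → ℝ := fun p =>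
    ∑ i with split p.1 (R p.2) i = k, h p.1 (R p.2) (fun i => W i p.2) (W i p.2) with hZ
  -- The factor `n / √N` is at most `√N`, as `n ≤ N`.
  have hmean : Tendsto (fun p : ℕ × Ω => 1 / √((K * p.1 : ℕ) : ℝ) * (p.1 * I p)) (whp μ) (𝓝 0) := by
    rw [tendsto_zero_iff_enorm]
    refine tendsto_of_tendsto_of_tendsto_of_le_of_le tendsto_const_nhds h1
      (fun _ => bot_le) fun p => ?_
    simp only [enorm_mul, ← mul_assoc]
    gcongr
    rw [← enorm_mul, ← ofReal_norm]
    refine ENNReal.ofReal_le_ofReal ?_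
    rw [Real.norm_of_nonneg (by positivity), one_div_mul_eq_div]
    refine div_le_of_le_mul₀ (Real.sqrt_nonneg _) (Real.sqrt_nonneg _) ?_
    rw [Real.mul_self_sqrt (Nat.cast_nonneg _)]
    exact_mod_cast Nat.le_mul_of_pos_left _ hK
  have hcent : Tendsto (fun p : ℕ × Ω => 1 / √((K * p.1 : ℕ) : ℝ) * (Z p - p.1 * I p))
      (whp μ) (𝓝 0) := by
    rw [Metric.tendsto_nhds]
    intro ε hε
    refine eventually_whp_of_forall_pos fun η hη => ?_
    -- With this `γ`, Chebyshev's bound `n γ ^ 2 / (ε √N) ^ 2` equals `η n / N ≤ η`.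
    set γ : ℝ := √(η * ε ^ 2) with hγ
    have hγ0 : 0 < γ := Real.sqrt_pos.2 (by positivity)
    have hγ2 : γ ^ 2 = η * ε ^ 2 := Real.sq_sqrt (by positivity)
    refine ⟨_, ENNReal.tendsto_nhds_zero.1 h2 (ENNReal.ofReal γ) (ENNReal.ofReal_pos.2 hγ0), ?_⟩
    filter_upwards [eventually_gt_atTop 0] with n hn
    have hNn : 0 < K * n := Nat.mul_pos hK hn
    have hN : (0 : ℝ) < ((K * n : ℕ) : ℝ) := by exact_mod_cast hNn
    have hs : (0 : ℝ) < √((K * n : ℕ) : ℝ) := Real.sqrt_pos.2 hN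
    have := chebyshev_fold hW hlaw hindep hR hRW (hsplit n) k (hcard n) (hh n) (hdep n) hγ0.le
      (mul_pos hε hs)
    refine (measure_mono fun ω hω => ?_).trans (this.trans ?_)
    · refine ⟨hω.1, ?_⟩
      have h3 := hω.2
      simp only [dist_zero_right, not_lt, norm_mul, Real.norm_eq_abs, one_div, abs_inv,
        abs_of_pos hs] at h3
      rw [inv_mul_eq_div, le_div_iff₀ hs] at h3
      exact h3
    · rw [← ENNReal.ofReal_coe_nnreal]
      refine ENNReal.ofReal_le_ofReal ?_
      rw [mul_pow, hγ2, Real.sq_sqrt hN.le, div_le_iff₀ (by positivity)]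
      have : (n : ℝ) ≤ ((K * n : ℕ) : ℝ) := by exact_mod_cast Nat.le_mul_of_pos_left n hK
      have h4 : (0 : ℝ) ≤ η * ε ^ 2 := by positivity
      nlinarith
  have := hcent.add hmean
  rw [add_zero] at this
  refine this.congr fun p => ?_
  ring

/-- Normalized sums of centered functions that are bounded in `L²` are bounded in probability. -/
lemma bigOpOne_normalized_sum (hW : ∀ i, Measurable (W i)) (hlaw : ∀ i, μ.map (W i) = ν)
    (hindep : iIndepFun W μ) (K : ℕ) {s : ℕ → 𝒲 → ℝ} (hs : ∀ n, Measurable (s n))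
    (h0 : ∀ n, ∫ x, s n x ∂ν = 0) {C : ℝ≥0} (h2 : ∀ n, eLpNorm (s n) 2 ν ≤ C) :
    BigOpOne μ fun n ω => ‖1 / √((K * n : ℕ) : ℝ) * ∑ i : Fin (K * n), s n (W i ω)‖ₑ := by
  intro ε hε
  obtain ⟨η, hη, hηε⟩ := ENNReal.lt_iff_exists_nnreal_btwn.1 hε
  have hη' : (0 : ℝ) < η := by exact_mod_cast hη
  -- Chebyshev's bound is `C ^ 2 / M ^ 2`, which is at most `η`; adding one keeps `M` positive when
  -- `C = 0`.
  set M : ℝ := √(C ^ 2 / η) + 1 with hM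
  have hM0 : 0 < M := by positivity
  refine ⟨M.toNNReal, Eventually.of_forall fun n => ?_⟩
  rcases Nat.eq_zero_or_pos (K * n) with hN0 | hNn
  · simp [hN0]
  have hN : (0 : ℝ) < ((K * n : ℕ) : ℝ) := by exact_mod_cast hNn
  have hsq : (0 : ℝ) < √((K * n : ℕ) : ℝ) := Real.sqrt_pos.2 hN
  have hch := pi_chebyshev (ι := Fin (K * n)) (hs n) C.coe_nonneg (mul_pos hM0 hsq)
    (by simpa using h2 n)
  rw [← map_sample_eq_pi hW hlaw hindep, Measure.map_apply
    (measurable_pi_lambda _ fun i : Fin (K * n) => hW i) ?_] at hch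
  · refine (measure_mono fun ω hω => ?_).trans (hch.trans ?_)
    · simp only [Set.mem_ofPred_eq] at hω
      rw [← ofReal_norm] at hω
      replace hω := (ENNReal.ofReal_lt_ofReal_iff'.1 hω).1
      rw [norm_mul, Real.norm_of_nonneg (by positivity), one_div, inv_mul_eq_div,
        lt_div_iff₀ hsq] at hω
      simp only [Set.mem_preimage, Set.mem_ofPred_eq, h0, mul_zero, sub_zero]
      exact hω.le
    · refine le_trans ?_ hηε.le
      rw [← ENNReal.ofReal_coe_nnreal]
      refine ENNReal.ofReal_le_ofReal ?_
      rw [Fintype.card_fin, mul_pow, Real.sq_sqrt hN.le, div_le_iff₀ (by positivity)]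
      have h5 : (C : ℝ) ^ 2 / η ≤ M ^ 2 := by
        rw [← Real.sq_sqrt (show (0 : ℝ) ≤ (C : ℝ) ^ 2 / η by positivity)]
        exact pow_le_pow_left₀ (Real.sqrt_nonneg _) (by simp [hM]) 2
      rw [div_le_iff₀ hη'] at h5
      nlinarith
  · refine measurableSet_le measurable_const (Measurable.abs ?_)
    refine Measurable.sub ?_ measurable_const
    exact Finset.measurable_fun_sum _ fun i _ => (hs n).comp (measurable_pi_apply i)

end Chebyshev

/-! ### Uniform integrability -/

section UniformIntegrability

variable {ι α : Type*} [m0 : MeasurableSpace α] {ν : Measure α} {p : ℝ≥0∞}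

lemma uniformIntegrable_of_norm_le {f g : ι → α → ℝ} (hf : UniformIntegrable f p ν)
    (hg : ∀ i, AEStronglyMeasurable (g i) ν) {B : ℝ}
    (h : ∀ i, ∀ᵐ x ∂ν, ‖g i x‖ ≤ B * ‖f i x‖) : UniformIntegrable g p ν := by
  set C : ℝ := max B 1 with hC
  have hC0 : 0 < C := lt_max_of_lt_right one_pos
  have h' : ∀ i, ∀ᵐ x ∂ν, ‖g i x‖ ≤ C * ‖f i x‖ := fun i => by
    filter_upwards [h i] with x hx
    exact hx.trans (mul_le_mul_of_nonneg_right (le_max_left _ _) (norm_nonneg _))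
  obtain ⟨-, hu, M, hM⟩ := hf
  refine ⟨hg, fun ε hε => ?_, C.toNNReal * M, fun i => ?_⟩
  · obtain ⟨δ, hδ, hs⟩ := hu (div_pos hε hC0)
    refine ⟨δ, hδ, fun i s hsm hsδ => ?_⟩
    have : eLpNorm (s.indicator (g i)) p ν ≤ ENNReal.ofReal C * eLpNorm (s.indicator (f i)) p ν := by
      refine eLpNorm_le_mul_eLpNorm_of_ae_le_mul ?_ p
      filter_upwards [h' i] with x hx
      by_cases hxs : x ∈ s <;> simp [hxs]
      simpa using hx
    refine this.trans ((mul_le_mul_right (hs i s hsm hsδ) _).trans ?_)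
    rw [← ENNReal.ofReal_mul hC0.le, mul_div_cancel₀ _ hC0.ne']
  · rw [ENNReal.coe_mul]
    exact (eLpNorm_le_mul_eLpNorm_of_ae_le_mul (h' i) p).trans (mul_le_mul_right (hM i) _)

lemma uniformIntegrable_add {f g : ι → α → ℝ} (hp : 1 ≤ p) (hf : UniformIntegrable f p ν)
    (hg : UniformIntegrable g p ν) : UniformIntegrable (fun i x => f i x + g i x) p ν := by
  obtain ⟨M, hM⟩ := hf.2.2
  obtain ⟨N, hN⟩ := hg.2.2
  refine ⟨fun i => (hf.1 i).add (hg.1 i), hf.2.1.add hg.2.1 hp hf.1 hg.1, M + N, fun i => ?_⟩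
  rw [ENNReal.coe_add]
  exact (eLpNorm_add_le (hf.1 i) (hg.1 i) hp).trans (add_le_add (hM i) (hN i))

lemma uniformIntegrable_sum {T : Type*} {f : T → ι → α → ℝ} (hp : 1 ≤ p) (hp' : p ≠ ∞)
    (s : Finset T) (hf : ∀ t ∈ s, UniformIntegrable (f t) p ν) :
    UniformIntegrable (fun i x => ∑ t ∈ s, f t i x) p ν := by
  classical
  induction s using Finset.induction_on with
  | empty => simpa using uniformIntegrable_const hp hp' (MemLp.zero' (ε := ℝ))
  | insert t s ht ih =>
    simp only [Finset.sum_insert ht]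
    exact uniformIntegrable_add hp (hf t (Finset.mem_insert_self _ _))
      (ih fun u hu => hf u (Finset.mem_insert_of_mem hu))

/-- A level set of `ν[g | ℱ i]` belongs to `ℱ i`, so restricting to it commutes with conditioning,
and conditioning contracts the `L^p` norm. By Markov's inequality these sets have small measure
uniformly in `i`, so absolute continuity of the `L^p` norm of the single function `g` concludes. The
σ-algebras need not be nested. -/
lemma uniformIntegrable_condExp_of_memLp [IsFiniteMeasure ν] {g : α → ℝ} (hp : 1 ≤ p)
    (hp' : p ≠ ∞) (hg : MemLp g p ν) {ℱ : ι → MeasurableSpace α} (hℱ : ∀ i, ℱ i ≤ m0) :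
    UniformIntegrable (fun i => ν[g | ℱ i]) p ν := by
  have hint : Integrable g ν := hg.integrable hp
  have hmeas : ∀ i, ∀ C : ℝ≥0, MeasurableSet[ℱ i] {x | C ≤ ‖(ν[g|ℱ i]) x‖₊} := fun i C =>
    (measurable_nnnorm.comp (stronglyMeasurable_condExp (m := ℱ i)).measurable) measurableSet_Ici
  refine uniformIntegrable_of hp hp'
    (fun i => (stronglyMeasurable_condExp.mono (hℱ i)).aestronglyMeasurable) fun ε hε => ?_
  obtain ⟨δ, hδ, h⟩ := hg.eLpNorm_indicator_le hp hp' hε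
  set c : ℝ≥0 := (eLpNorm g 1 ν).toNNReal with hc
  have hcg : (c : ℝ≥0∞) = eLpNorm g 1 ν :=
    ENNReal.coe_toNNReal (memLp_one_iff_integrable.2 hint).2.ne
  refine ⟨c / δ.toNNReal + 1, fun i => ?_⟩
  -- Markov's bound `c / C` is then at most `δ`, and `C` is nonzero even if `g` vanishes.
  set C : ℝ≥0 := c / δ.toNNReal + 1 with hC
  have hδ' : 0 < δ.toNNReal := Real.toNNReal_pos.2 hδ
  have hsmall : ν {x | C ≤ ‖(ν[g|ℱ i]) x‖₊} ≤ ENNReal.ofReal δ := by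
    have h1 : (C : ℝ≥0∞) * ν {x | (C : ℝ≥0∞) ≤ ‖(ν[g|ℱ i]) x‖ₑ ^ (1 : ℝ≥0∞).toReal}
        ≤ eLpNorm (ν[g|ℱ i]) 1 ν ^ (1 : ℝ≥0∞).toReal :=
      mul_meas_ge_le_pow_eLpNorm ν one_ne_zero ENNReal.one_ne_top
        (stronglyMeasurable_condExp.mono (hℱ i)).aestronglyMeasurable C
    simp only [ENNReal.toReal_one, ENNReal.rpow_one, enorm_eq_nnnorm, ENNReal.coe_le_coe] at h1
    have h2 := h1.trans (eLpNorm_condExp_le_eLpNorm g le_rfl)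
    rw [← hcg] at h2
    have hC0 : C ≠ 0 := by positivity
    rw [mul_comm, ← ENNReal.le_div_iff_mul_le (Or.inl (ENNReal.coe_ne_zero.2 hC0))
      (Or.inl ENNReal.coe_ne_top)] at h2
    refine h2.trans ?_
    rw [← ENNReal.coe_div hC0]
    refine ENNReal.coe_le_coe.2 (NNReal.div_le_of_le_mul ?_)
    rw [hC, mul_add, mul_div_cancel₀ _ hδ'.ne']
    exact le_self_add
  have hae := condExp_indicator hint (hmeas i C)
  rw [← eLpNorm_congr_ae hae]
  exact (eLpNorm_condExp_le_eLpNorm _ hp).trans (h _ (hℱ i _ (hmeas i C)) hsmall)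

end UniformIntegrability

lemma integral_mul_condExp {α : Type*} {m m0 : MeasurableSpace α} {ν : Measure α}
    [IsFiniteMeasure ν] (hm : m ≤ m0) {φ f : α → ℝ} (hφ : StronglyMeasurable[m] φ)
    (hφf : Integrable (fun x => φ x * f x) ν) (hf : Integrable f ν) :
    ∫ x, φ x * (ν[f | m]) x ∂ν = ∫ x, φ x * f x ∂ν := by
  rw [← integral_condExp hm (f := fun x => φ x * f x)]
  exact integral_congr_ae (condExp_mul_of_stronglyMeasurable_left hφ hφf hf).symm

/-! ### The model -/

namespace Model

variable {T 𝒲 : Type*} {𝒳 Z : ℕ → Type*} [MeasurableSpace 𝒲] [∀ n, MeasurableSpace (𝒳 n)]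
  (S : Model T 𝒲 𝒳 Z)

instance : IsProbabilityMeasure S.law := S.law_isProb

/-- The propensity scores are at least `c` and at most `1 - c`. -/
def PropensityBounds (c : ℝ) : Prop :=
  ∀ n τ, ∀ᵐ w ∂S.law, c ≤ (S.eta n).q τ (S.X n w) ∧ (S.eta n).q τ (S.X n w) ≤ 1 - c

lemma sigmaX_le (n : ℕ) : S.sigmaX n ≤ (inferInstance : MeasurableSpace 𝒲) :=
  (S.measurable_X n).comap_le

lemma measurable_G (τ : T) : Measurable (S.G τ) :=
  measurable_const.indicator (S.measurableSet_group τ)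

lemma abs_G_le_one (τ : T) (w : 𝒲) : |S.G τ w| ≤ 1 := by
  by_cases h : w ∈ S.group τ <;> simp [G, h]

lemma integrable_G (τ : T) : Integrable (S.G τ) S.law :=
  Integrable.of_bound (S.measurable_G τ).aestronglyMeasurable 1 (ae_of_all _ (S.abs_G_le_one τ))

lemma integral_mul_G (τ : T) (f : 𝒲 → ℝ) :
    ∫ w, f w * S.G τ w ∂S.law = ∫ w in S.group τ, f w ∂S.law := by
  rw [← integral_indicator (S.measurableSet_group τ)]
  refine integral_congr_ae (ae_of_all _ fun w => ?_)
  by_cases h : w ∈ S.group τ <;> simp [G, h]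

lemma stronglyMeasurable_comp_X {n : ℕ} {φ : 𝒳 n → ℝ} (hφ : Measurable φ) :
    StronglyMeasurable[S.sigmaX n] fun w => φ (S.X n w) :=
  (hφ.comp (comap_measurable (S.X n))).stronglyMeasurable

variable {S} {c : ℝ}

section

variable (hS : S.TrueNuisance)
include hS

lemma integral_comp_X_mul_G {n : ℕ} (τ : T) {φ : 𝒳 n → ℝ} (hφ : Measurable φ)
    (hint : Integrable (fun w => φ (S.X n w)) S.law) :
    ∫ w, φ (S.X n w) * S.G τ w ∂S.law = ∫ w, φ (S.X n w) * (S.eta n).q τ (S.X n w) ∂S.law := by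
  have hI : Integrable (fun w => φ (S.X n w) * S.G τ w) S.law :=
    hint.mul_bdd (S.measurable_G τ).aestronglyMeasurable (ae_of_all _ (S.abs_G_le_one τ))
  rw [← integral_mul_condExp (S.sigmaX_le n) (S.stronglyMeasurable_comp_X hφ) hI
    (S.integrable_G τ)]
  refine integral_congr_ae ?_
  filter_upwards [(hS n τ).1] with w hw
  rw [hw]

lemma setIntegral_q (n : ℕ) (τ : T) {A : Set (𝒳 n)} (hA : MeasurableSet A) :
    ∫ w in S.X n ⁻¹' A, (S.eta n).q τ (S.X n w) ∂S.law
      = S.law.real (S.group τ ∩ S.X n ⁻¹' A) := by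
  have hA' : MeasurableSet[S.sigmaX n] (S.X n ⁻¹' A) := ⟨A, hA, rfl⟩
  rw [setIntegral_congr_ae (g := S.law[S.G τ | S.sigmaX n]) (S.measurable_X n hA)
    ((hS n τ).1.mono fun w hw _ => hw), setIntegral_condExp (S.sigmaX_le n) (S.integrable_G τ) hA']
  rw [G, integral_indicator_const _ (S.measurableSet_group τ)]
  simp [measureReal_restrict_apply (S.measurableSet_group τ)]

lemma le_measureReal_group_inter (hq : S.PropensityBounds c) (n : ℕ) (τ : T) {A : Set (𝒳 n)}
    (hA : MeasurableSet A) :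
    c * S.law.real (S.X n ⁻¹' A) ≤ S.law.real (S.group τ ∩ S.X n ⁻¹' A) := by
  rw [← setIntegral_q hS n τ hA]
  have hint : Integrable (fun w => (S.eta n).q τ (S.X n w)) S.law :=
    integrable_condExp.congr (hS n τ).1.symm
  calc c * S.law.real (S.X n ⁻¹' A) = ∫ _ in S.X n ⁻¹' A, c ∂S.law := by simp [mul_comm]
    _ ≤ _ := integral_mono_ae (integrable_const _) hint.integrableOn
      (ae_restrict_of_ae ((hq n τ).mono fun w hw => hw.1))

lemma le_measureReal_group (hq : S.PropensityBounds c) (τ : T) : c ≤ S.law.real (S.group τ) := by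
  simpa using le_measureReal_group_inter hS hq 0 τ MeasurableSet.univ

lemma q1_pos (hc : 0 < c) (hq : S.PropensityBounds c) : 0 < S.q1 :=
  hc.trans_le (le_measureReal_group hS hq S.one)

lemma law_group_ne_zero (hc : 0 < c) (hq : S.PropensityBounds c) (τ : T) :
    S.law (S.group τ) ≠ 0 := fun h => by
  have := le_measureReal_group hS hq τ
  rw [measureReal_def, h] at this
  simp only [ENNReal.toReal_zero] at this
  linarith

lemma isProbabilityMeasure_cond_group (hc : 0 < c) (hq : S.PropensityBounds c) (τ : T) :
    IsProbabilityMeasure (S.law[|S.group τ]) :=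
  cond_isProbabilityMeasure (law_group_ne_zero hS hc hq τ)

/-- By overlap, the law of the covariates is dominated by their law in each group. -/
lemma map_X_le (hc : 0 < c) (hq : S.PropensityBounds c) (n : ℕ) (τ : T) :
    S.law.map (S.X n) ≤ ENNReal.ofReal c⁻¹ • (S.law[|S.group τ]).map (S.X n) := by
  refine Measure.le_iff.2 fun A hA => ?_
  rw [Measure.smul_apply, Measure.map_apply (S.measurable_X n) hA,
    Measure.map_apply (S.measurable_X n) hA, cond_apply (S.measurableSet_group τ), smul_eq_mul]
  -- Conditioning divides by a probability, which is at most one, so it only increases the measure.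
  have h1 : S.law (S.group τ ∩ S.X n ⁻¹' A)
      ≤ (S.law (S.group τ))⁻¹ * S.law (S.group τ ∩ S.X n ⁻¹' A) := by
    nth_rewrite 1 [← one_mul (S.law (S.group τ ∩ S.X n ⁻¹' A))]
    gcongr
    exact ENNReal.one_le_inv.2 prob_le_one
  refine le_trans ?_ (mul_le_mul_right h1 _)
  have h2 := le_measureReal_group_inter hS hq n τ hA
  rw [← ofReal_measureReal, ← ofReal_measureReal, ← ENNReal.ofReal_mul (by positivity)]
  refine ENNReal.ofReal_le_ofReal ?_
  rwa [inv_mul_eq_div, le_div_iff₀ hc, mul_comm]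

lemma eLpNorm_comp_X_le (hc : 0 < c) (hq : S.PropensityBounds c) {n : ℕ} (τ : T) {φ : 𝒳 n → ℝ}
    (hφ : Measurable φ) :
    eLpNorm (fun w => φ (S.X n w)) 2 S.law
      ≤ ENNReal.ofReal c⁻¹ ^ (1 / 2 : ℝ) * eLpNorm (fun w => φ (S.X n w)) 2 (S.law[|S.group τ]) := by
  have h := eLpNorm_mono_measure (p := 2) φ (map_X_le hS hc hq n τ)
  rw [eLpNorm_smul_measure_of_ne_top (by norm_num), eLpNorm_map_measure
    hφ.aestronglyMeasurable (S.measurable_X n).aemeasurable, eLpNorm_map_measure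
    hφ.aestronglyMeasurable (S.measurable_X n).aemeasurable] at h
  simpa [Function.comp_def] using h

lemma memLp_cond {f : 𝒲 → ℝ} (hc : 0 < c) (hq : S.PropensityBounds c) (τ : T)
    (hf : MemLp f 2 S.law) : MemLp f 2 (S.law[|S.group τ]) :=
  (hf.restrict _).smul_measure (ENNReal.inv_ne_top.2 (law_group_ne_zero hS hc hq τ))

/-- Under the law given `G_τ = 1` these functions are conditional expectations of `Ỹ` on varying
σ-algebras, hence uniformly integrable there. Overlap carries this over to the population law at the
price of the factor `c^{-1/2}`. -/
lemma uniformIntegrable_m (hc : 0 < c) (hq : S.PropensityBounds c) (hY : MemLp S.Y 2 S.law)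
    (τ : T) : UniformIntegrable (fun n w => (S.eta n).m τ (S.X n w)) 2 S.law := by
  have := isProbabilityMeasure_cond_group hS hc hq τ
  have hui : UniformIntegrable (fun n w => (S.eta n).m τ (S.X n w)) 2 (S.law[|S.group τ]) :=
    (uniformIntegrable_condExp_of_memLp (by norm_num) (by norm_num) (memLp_cond hS hc hq τ hY)
      S.sigmaX_le).ae_eq fun n => (hS n τ).2.symm
  refine uniformIntegrable_of (by norm_num) (by norm_num)
    (fun n => ((S.measurable_m n τ).comp (S.measurable_X n)).aestronglyMeasurable) fun ε hε => ?_
  set b : ℝ := (c⁻¹) ^ (1 / 2 : ℝ) with hb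
  have hb0 : 0 < b := by positivity
  obtain ⟨C, hC⟩ := hui.spec (by norm_num) (by norm_num) (div_pos hε hb0)
  refine ⟨C, fun n => ?_⟩
  -- The truncated regression is still a function of the covariates, so the comparison of the two
  -- laws applies to it.
  have hφ : Measurable ({x : 𝒳 n | C ≤ ‖(S.eta n).m τ x‖₊}.indicator ((S.eta n).m τ)) :=
    (S.measurable_m n τ).indicator
      (measurableSet_le measurable_const (S.measurable_m n τ).nnnorm)
  refine (eLpNorm_comp_X_le hS hc hq τ hφ).trans ((mul_le_mul_right (hC n) _).trans ?_)
  rw [ENNReal.ofReal_rpow_of_pos (by positivity), ← ENNReal.ofReal_mul hb0.le,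
    mul_div_cancel₀ _ hb0.ne']

lemma uniformIntegrable_residual (hc : 0 < c) (hq : S.PropensityBounds c)
    (hY : MemLp S.Y 2 S.law) (τ : T) :
    UniformIntegrable (fun n w => S.Y w - (S.eta n).m τ (S.X n w)) 2 S.law := by
  have hm := uniformIntegrable_m hS hc hq hY τ
  have h := uniformIntegrable_add (by norm_num)
    (uniformIntegrable_const (ι := ℕ) (by norm_num) (by norm_num) hY)
    (uniformIntegrable_of_norm_le (g := fun n w => -(S.eta n).m τ (S.X n w)) (B := 1) hm
      (fun n => (hm.1 n).neg) fun n => ae_of_all _ fun w => by simp)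
  simpa [sub_eq_add_neg] using h

/-- The residuals are orthogonal to functions of the covariates within each group. -/
lemma integral_comp_X_mul_residual (hc : 0 < c) (hq : S.PropensityBounds c)
    (hY : MemLp S.Y 2 S.law) {n : ℕ} (τ : T) {φ : 𝒳 n → ℝ} (hφ : Measurable φ) {B : ℝ}
    (hB : ∀ᵐ w ∂S.law, ‖φ (S.X n w)‖ ≤ B) :
    ∫ w, φ (S.X n w) * (S.Y w - (S.eta n).m τ (S.X n w)) * S.G τ w ∂S.law = 0 := by
  have := isProbabilityMeasure_cond_group hS hc hq τ
  have hYc := (memLp_cond hS hc hq τ hY).integrable (by norm_num)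
  have hφm := (hφ.comp (S.measurable_X n)).aestronglyMeasurable (μ := S.law[|S.group τ])
  have hBc : ∀ᵐ w ∂(S.law[|S.group τ]), ‖φ (S.X n w)‖ ≤ B :=
    (cond_absolutelyContinuous (μ := S.law) (s := S.group τ)).ae_le hB
  have hmc : Integrable (fun w => (S.eta n).m τ (S.X n w)) (S.law[|S.group τ]) :=
    integrable_condExp.congr (hS n τ).2.symm
  have hiY : Integrable (fun w => φ (S.X n w) * S.Y w) (S.law[|S.group τ]) :=
    hYc.bdd_mul hφm hBc
  have him : Integrable (fun w => φ (S.X n w) * (S.eta n).m τ (S.X n w)) (S.law[|S.group τ]) :=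
    hmc.bdd_mul hφm hBc
  have h0 : ∫ w, φ (S.X n w) * (S.Y w - (S.eta n).m τ (S.X n w)) ∂(S.law[|S.group τ]) = 0 := by
    simp only [mul_sub]
    rw [integral_sub hiY him, sub_eq_zero, ← integral_mul_condExp (S.sigmaX_le n)
      (S.stronglyMeasurable_comp_X hφ) hiY hYc]
    refine integral_congr_ae ?_
    filter_upwards [(hS n τ).2] with w hw
    rw [hw]
  rw [integral_mul_G]
  -- The conditional law is a nonzero multiple of the restriction to the group, so the integral over
  -- the group vanishes too.
  rw [ProbabilityTheory.cond, integral_smul_measure] at h0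
  refine (smul_eq_zero.1 h0).resolve_left ?_
  exact (ENNReal.toReal_pos (ENNReal.inv_ne_zero.2 (measure_ne_top _ _))
    (ENNReal.inv_ne_top.2 (law_group_ne_zero hS hc hq τ))).ne'

end

lemma abs_ratio_le (hc : 0 < c) (n : ℕ) {η : Nuisance T (𝒳 n) (Z n)} (τ : T) {w : 𝒲}
    (h1 : 0 ≤ η.q S.one (S.X n w) ∧ η.q S.one (S.X n w) ≤ 1) (hτ : c ≤ η.q τ (S.X n w)) :
    |S.ratio n η τ w| ≤ c⁻¹ := by
  rw [ratio, abs_div, abs_of_nonneg h1.1, abs_of_pos (hc.trans_le hτ), inv_eq_one_div]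
  gcongr
  exact h1.2

lemma measurable_ratio (n : ℕ) {η : Nuisance T (𝒳 n) (Z n)} (hη : ∀ τ, Measurable (η.q τ))
    (τ : T) : Measurable (S.ratio n η τ) :=
  ((hη _).comp (S.measurable_X n)).div ((hη _).comp (S.measurable_X n))

lemma ae_abs_ratio_eta_le (hc : 0 < c) (hq : S.PropensityBounds c) (n : ℕ) (τ : T) :
    ∀ᵐ w ∂S.law, |S.ratio n (S.eta n) τ w| ≤ c⁻¹ := by
  filter_upwards [hq n S.one, hq n τ] with w h1 hτ
  exact abs_ratio_le hc n τ ⟨hc.le.trans h1.1, by linarith [h1.2]⟩ hτ.1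

/-- The adjustment term is uniformly bounded. -/
lemma exists_abs_psib_le (hS : S.TrueNuisance) (hc : 0 < c) (hq : S.PropensityBounds c)
    (hbC : S.AdjustmentBounded) :
    ∃ B : ℝ, 0 ≤ B ∧ ∀ n, ∀ᵐ w ∂S.law, |S.psib n w (S.eta n)| ≤ B := by
  obtain ⟨C, hC⟩ := hbC
  have hq1 := q1_pos hS hc hq
  refine ⟨1 / S.q1 * c⁻¹ + |C|, by positivity, fun n => ?_⟩
  filter_upwards [hC n S.one, ae_abs_ratio_eta_le hc hq n S.one] with w h1 h2
  have h3 : |S.G S.one w / S.q1 * S.ratio n (S.eta n) S.one w| ≤ 1 / S.q1 * c⁻¹ := by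
    rw [abs_mul, abs_div, abs_of_pos hq1]
    gcongr
    exact S.abs_G_le_one _ _
  calc |S.psib n w (S.eta n)| = |S.G S.one w / S.q1 * S.ratio n (S.eta n) S.one w
        - (S.G S.one w / S.q1 * S.ratio n (S.eta n) S.one w - S.psib n w (S.eta n))| := by
        rw [sub_sub_cancel]
    _ ≤ _ := (abs_sub _ _).trans (add_le_add h3 (h1.trans (le_abs_self C)))

lemma integral_comp_X_mul_psib (hb : S.AdjustmentMean) {n : ℕ} {B : ℝ}
    (hB : ∀ᵐ w ∂S.law, |S.psib n w (S.eta n)| ≤ B) {φ : 𝒳 n → ℝ} (hφ : Measurable φ)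
    (hint : Integrable (fun w => φ (S.X n w)) S.law) :
    ∫ w, φ (S.X n w) * S.psib n w (S.eta n) ∂S.law
      = ∫ w, φ (S.X n w) * ((S.eta n).q S.one (S.X n w) / S.q1) ∂S.law := by
  have hm := (S.measurable_psib_eta n).aestronglyMeasurable (μ := S.law)
  rw [← integral_mul_condExp (S.sigmaX_le n) (S.stronglyMeasurable_comp_X hφ)
    (hint.mul_bdd hm hB) (Integrable.of_bound hm B hB)]
  refine integral_congr_ae ?_
  filter_upwards [hb n] with w hw
  rw [hw]

/-- Averaging `E[ψ^b | X] = q_1(X) / q_1` gives one because `E[q_1(X)] = q_1`. This is the limit of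
the denominator of the estimator. -/
lemma integral_psib (hS : S.TrueNuisance) (hc : 0 < c) (hq : S.PropensityBounds c)
    (hb : S.AdjustmentMean) {n : ℕ} {B : ℝ} (hB : ∀ᵐ w ∂S.law, |S.psib n w (S.eta n)| ≤ B) :
    ∫ w, S.psib n w (S.eta n) ∂S.law = 1 := by
  have h1 := integral_comp_X_mul_psib hb hB (φ := fun _ => 1) measurable_const (integrable_const _)
  have h2 := setIntegral_q hS n S.one MeasurableSet.univ
  simp only [one_mul, Set.preimage_univ, setIntegral_univ, Set.inter_univ] at h1 h2
  rw [h1, integral_div, h2]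
  exact div_self (q1_pos hS hc hq).ne'

/-- The adjustment term and the inverse propensity weight have the same conditional mean. -/
lemma integral_comp_X_mul_psib_sub (hS : S.TrueNuisance) (hc : 0 < c) (hq : S.PropensityBounds c)
    (hb : S.AdjustmentMean) {n : ℕ} {B : ℝ} (hB : ∀ᵐ w ∂S.law, |S.psib n w (S.eta n)| ≤ B)
    (τ : T) {φ : 𝒳 n → ℝ} (hφ : Measurable φ)
    (hint : Integrable (fun w => φ (S.X n w)) S.law) :
    ∫ w, φ (S.X n w)
      * (S.psib n w (S.eta n) - S.ratio n (S.eta n) τ w * S.G τ w / S.q1) ∂S.law = 0 := by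
  have hm := (S.measurable_psib_eta n).aestronglyMeasurable (μ := S.law)
  have hr := (S.measurable_ratio n (S.measurable_q n) τ).aestronglyMeasurable (μ := S.law)
  have hi2 : Integrable (fun w => φ (S.X n w) * S.ratio n (S.eta n) τ w) S.law :=
    hint.mul_bdd hr (ae_abs_ratio_eta_le hc hq n τ)
  have hi3 : Integrable (fun w => φ (S.X n w) * S.ratio n (S.eta n) τ w * S.G τ w) S.law :=
    hi2.mul_bdd (S.measurable_G τ).aestronglyMeasurable (ae_of_all _ (S.abs_G_le_one τ))
  have e : ∀ w, φ (S.X n w)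
      * (S.psib n w (S.eta n) - S.ratio n (S.eta n) τ w * S.G τ w / S.q1)
      = φ (S.X n w) * S.psib n w (S.eta n)
        - φ (S.X n w) * S.ratio n (S.eta n) τ w * S.G τ w / S.q1 := fun w => by ring
  simp_rw [e]
  rw [integral_sub (hint.mul_bdd hm hB) (hi3.div_const _), integral_div,
    integral_comp_X_mul_psib hb hB hφ hint, sub_eq_zero]
  -- Conditioning on `X` replaces `G_τ` by `q_{G_τ}(X)`, which cancels the denominator of the ratio.
  have h := integral_comp_X_mul_G hS τ (n := n)
    (φ := fun x => φ x * ((S.eta n).q S.one x / (S.eta n).q τ x))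
    (hφ.mul ((S.measurable_q n _).div (S.measurable_q n _))) hi2
  simp only [ratio]
  rw [h, ← integral_div]
  refine integral_congr_ae ?_
  filter_upwards [hq n τ] with w hw
  have : (S.eta n).q τ (S.X n w) ≠ 0 := (hc.trans_le hw.1).ne'
  field_simp

lemma measurable_score [Fintype T] (n : ℕ) {η : Nuisance T (𝒳 n) (Z n)}
    (hη : ∀ τ, Measurable (η.q τ)) (hm : ∀ τ, Measurable (η.m τ))
    (hb : Measurable fun w => S.psib n w η) (θ : ℝ) : Measurable fun w => S.score n w η θ := by
  have hX := S.measurable_X n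
  have hY := S.measurable_Y
  have hG := S.measurable_G
  unfold score psi
  refine Measurable.sub (Finset.measurable_fun_sum _ fun τ _ => Measurable.const_mul ?_ _)
    (hb.mul_const _)
  have h1 := (hη S.one).comp hX
  have h2 := (hη τ).comp hX
  have h3 := (hm τ).comp hX
  exact (((h1.div_const _).mul ((hG τ).div h2)).mul (hY.sub h3)).add (hb.mul h3)

/-- Overlap and boundedness of `ψ^b(W, η)` make each term a bounded weight times a residual, a
regression or a constant, and these are uniformly square integrable. -/
lemma uniformIntegrable_score [Fintype T] (hS : S.TrueNuisance) (hc : 0 < c)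
    (hq : S.PropensityBounds c) (hY : MemLp S.Y 2 S.law) {B : ℝ}
    (hB : ∀ n, ∀ᵐ w ∂S.law, |S.psib n w (S.eta n)| ≤ B) (θ : ℝ) :
    UniformIntegrable (fun n w => S.score n w (S.eta n) θ) 2 S.law := by
  have hq1 := q1_pos hS hc hq
  have hXq : ∀ n τ, Measurable fun w => (S.eta n).q τ (S.X n w) := fun n τ =>
    (S.measurable_q n τ).comp (S.measurable_X n)
  have hXm : ∀ n τ, Measurable fun w => (S.eta n).m τ (S.X n w) := fun n τ =>
    (S.measurable_m n τ).comp (S.measurable_X n)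
  have hterm : ∀ τ, UniformIntegrable (fun n w => S.coef τ *
      ((S.eta n).q S.one (S.X n w) / S.q1 * (S.G τ w / (S.eta n).q τ (S.X n w))
        * (S.Y w - (S.eta n).m τ (S.X n w)) + S.psib n w (S.eta n) * (S.eta n).m τ (S.X n w)))
      2 S.law := by
    intro τ
    have h1 : UniformIntegrable (fun n w => (S.eta n).q S.one (S.X n w) / S.q1
        * (S.G τ w / (S.eta n).q τ (S.X n w)) * (S.Y w - (S.eta n).m τ (S.X n w))) 2 S.law := by
      refine uniformIntegrable_of_norm_le (uniformIntegrable_residual hS hc hq hY τ)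
        (B := c⁻¹ / S.q1) (fun n => ?_) fun n => ?_
      · exact ((((hXq n _).div_const _).mul ((S.measurable_G τ).div (hXq n τ))).mul
          (S.measurable_Y.sub (hXm n τ))).aestronglyMeasurable
      · filter_upwards [ae_abs_ratio_eta_le hc hq n τ] with w hw
        rw [norm_mul]
        gcongr
        have e : (S.eta n).q S.one (S.X n w) / S.q1 * (S.G τ w / (S.eta n).q τ (S.X n w))
            = S.ratio n (S.eta n) τ w * S.G τ w / S.q1 := by rw [ratio]; ring
        rw [e, Real.norm_eq_abs, abs_div, abs_of_pos hq1, abs_mul]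
        gcongr
        calc _ ≤ c⁻¹ * 1 := by gcongr; exact S.abs_G_le_one τ w
          _ = c⁻¹ := mul_one _
    have h2 : UniformIntegrable (fun n w => S.psib n w (S.eta n) * (S.eta n).m τ (S.X n w))
        2 S.law := by
      refine uniformIntegrable_of_norm_le (uniformIntegrable_m hS hc hq hY τ) (B := B)
        (fun n => ((S.measurable_psib_eta n).mul (hXm n τ)).aestronglyMeasurable) fun n => ?_
      filter_upwards [hB n] with w hw
      rw [norm_mul]
      gcongr
      exact hw
    have h12 := uniformIntegrable_add (by norm_num) h1 h2
    refine uniformIntegrable_of_norm_le h12 (B := |S.coef τ|) (fun n => (h12.1 n).const_mul _)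
      fun n => ae_of_all _ fun w => ?_
    rw [norm_mul, Real.norm_eq_abs (S.coef τ)]
  have hψ : UniformIntegrable (fun n w => -(S.psib n w (S.eta n) * θ)) 2 S.law := by
    refine uniformIntegrable_of_norm_le (f := fun _ _ => (1 : ℝ)) (B := B * |θ|)
      (uniformIntegrable_const (by norm_num) (by norm_num) (memLp_const 1))
      (fun n => ((S.measurable_psib_eta n).mul_const _).neg.aestronglyMeasurable) fun n => ?_
    filter_upwards [hB n] with w hw
    simp only [norm_neg, norm_mul, norm_one, mul_one, Real.norm_eq_abs]
    gcongr
  have := uniformIntegrable_add (by norm_num)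
    (uniformIntegrable_sum (by norm_num) (by norm_num) Finset.univ fun τ _ => hterm τ) hψ
  simpa only [← sub_eq_add_neg, score, psi] using this

end Model

/-! ### Bias and `L²` size of the error of the score -/

lemma enorm_integral_mul_le {α : Type*} [MeasurableSpace α] {ν : Measure α} {f g : α → ℝ}
    (hf : AEStronglyMeasurable f ν) (hg : AEStronglyMeasurable g ν) :
    ‖∫ x, f x * g x ∂ν‖ₑ ≤ eLpNorm f 2 ν * eLpNorm g 2 ν := by
  refine (enorm_integral_le_lintegral_enorm _).trans ?_
  rw [← eLpNorm_one_eq_lintegral_enorm]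
  have := eLpNorm_le_eLpNorm_mul_eLpNorm'_of_norm (p := 2) (q := 2) (r := 1) hf hg
    (fun x y : ℝ => x * y) 1 (ae_of_all _ fun x => by simp)
  simpa using this

lemma eLpNorm_mul_le_top_mul {α : Type*} [MeasurableSpace α] {ν : Measure α} {f g : α → ℝ}
    (hg : AEStronglyMeasurable g ν) :
    eLpNorm (fun x => f x * g x) 2 ν ≤ eLpNorm f ∞ ν * eLpNorm g 2 ν :=
  eLpNorm_smul_le_eLpNorm_top_mul_eLpNorm 2 hg f

lemma integral_sum_linear_combination {T α : Type*} [Fintype T] [MeasurableSpace α] {ν : Measure α}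
    {a : T → ℝ} {b : ℝ} {f₁ f₂ f₃ f₄ : T → α → ℝ} {g : α → ℝ} (h₁ : ∀ τ, Integrable (f₁ τ) ν)
    (h₂ : ∀ τ, Integrable (f₂ τ) ν) (h₃ : ∀ τ, Integrable (f₃ τ) ν)
    (h₄ : ∀ τ, Integrable (f₄ τ) ν) (hg : Integrable g ν) :
    ∫ x, ((∑ τ, a τ * (f₁ τ x - f₂ τ x + f₃ τ x + f₄ τ x)) - b * g x) ∂ν
      = (∑ τ, a τ * (∫ x, f₁ τ x ∂ν - ∫ x, f₂ τ x ∂ν + ∫ x, f₃ τ x ∂ν + ∫ x, f₄ τ x ∂ν))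
        - b * ∫ x, g x ∂ν := by
  have h12 : ∀ τ, Integrable (fun x => f₁ τ x - f₂ τ x) ν := fun τ => (h₁ τ).sub (h₂ τ)
  have h123 : ∀ τ, Integrable (fun x => f₁ τ x - f₂ τ x + f₃ τ x) ν := fun τ => (h12 τ).add (h₃ τ)
  have h1234 : ∀ τ, Integrable (fun x => f₁ τ x - f₂ τ x + f₃ τ x + f₄ τ x) ν := fun τ =>
    (h123 τ).add (h₄ τ)
  rw [integral_sub (integrable_finsetSum _ fun τ _ => (h1234 τ).const_mul _) (hg.const_mul b),
    integral_const_mul, integral_finsetSum _ fun τ _ => (h1234 τ).const_mul _]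
  congr 1
  refine Finset.sum_congr rfl fun τ _ => ?_
  rw [integral_const_mul, integral_add (h123 τ) (h₄ τ), integral_add (h12 τ) (h₃ τ),
    integral_sub (h₁ τ) (h₂ τ)]

/-- A bounded factor times `e` is small in `L²` if the factor is, up to the tails of `e`. -/
lemma eLpNorm_mul_le_add_tail {α : Type*} [MeasurableSpace α] {ν : Measure α} {d e : α → ℝ}
    (hd : Measurable d) (he : Measurable e) {b : ℝ} (hb : ∀ᵐ x ∂ν, |d x| ≤ b) (M : ℝ≥0) :
    eLpNorm (fun x => d x * e x) 2 ν
      ≤ M * eLpNorm d 2 ν + ENNReal.ofReal b * eLpNorm ({x | M ≤ ‖e x‖₊}.indicator e) 2 ν := by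
  have hs : MeasurableSet {x | M ≤ ‖e x‖₊} := measurableSet_le measurable_const he.nnnorm
  have h1 : (fun x => d x * e x) = (fun x => d x * {x | M ≤ ‖e x‖₊}ᶜ.indicator e x)
      + fun x => d x * {x | M ≤ ‖e x‖₊}.indicator e x := by
    ext x
    by_cases hx : x ∈ {x | M ≤ ‖e x‖₊}
    · simp [Set.indicator_of_mem hx, Set.indicator_of_notMem (fun h : x ∈ {x | M ≤ ‖e x‖₊}ᶜ => h hx)]
    · simp [Set.indicator_of_notMem hx, Set.indicator_of_mem (show x ∈ {x | M ≤ ‖e x‖₊}ᶜ from hx)]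
  rw [h1]
  refine (eLpNorm_add_le (hd.mul (he.indicator hs.compl)).aestronglyMeasurable
    (hd.mul (he.indicator hs)).aestronglyMeasurable (by norm_num)).trans (add_le_add ?_ ?_)
  · rw [← ENNReal.ofReal_coe_nnreal]
    refine eLpNorm_le_mul_eLpNorm_of_ae_le_mul (ae_of_all _ fun x => ?_) 2
    rw [Pi.mul_apply, norm_mul, mul_comm]
    gcongr
    by_cases hx : x ∈ {x | M ≤ ‖e x‖₊}
    · simp [Set.indicator_of_notMem (fun h : x ∈ {x | M ≤ ‖e x‖₊}ᶜ => h hx)]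
    · rw [Set.indicator_of_mem (show x ∈ {x | M ≤ ‖e x‖₊}ᶜ from hx)]
      have : ‖e x‖₊ ≤ M := (not_le.1 hx).le
      exact_mod_cast this
  · refine eLpNorm_le_mul_eLpNorm_of_ae_le_mul ?_ 2
    filter_upwards [hb] with x hx
    rw [Pi.mul_apply, norm_mul]
    gcongr
    exact hx

namespace Model

variable {T 𝒲 : Type*} {𝒳 Z : ℕ → Type*} [MeasurableSpace 𝒲] [∀ n, MeasurableSpace (𝒳 n)]
  (S : Model T 𝒲 𝒳 Z)

/-- The error of the estimated outcome regression. -/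
noncomputable def dm (n : ℕ) (η : Nuisance T (𝒳 n) (Z n)) (τ : T) (w : 𝒲) : ℝ :=
  η.m τ (S.X n w) - (S.eta n).m τ (S.X n w)

/-- The error of the estimated propensity ratio. -/
noncomputable def dratio (n : ℕ) (η : Nuisance T (𝒳 n) (Z n)) (τ : T) (w : 𝒲) : ℝ :=
  S.ratio n η τ w - S.ratio n (S.eta n) τ w

/-- The error of the estimated adjustment term. -/
noncomputable def dpsib (n : ℕ) (η : Nuisance T (𝒳 n) (Z n)) (w : 𝒲) : ℝ :=
  S.psib n w η - S.psib n w (S.eta n)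

/-- The residual of the outcome regression. -/
noncomputable def resid (n : ℕ) (τ : T) (w : 𝒲) : ℝ := S.Y w - (S.eta n).m τ (S.X n w)

/-- The error of the estimated score. -/
noncomputable def dscore [Fintype T] (n : ℕ) (η : Nuisance T (𝒳 n) (Z n)) (θ : ℝ) (w : 𝒲) : ℝ :=
  S.score n w η θ - S.score n w (S.eta n) θ

/-- The grouping that shows the bias: the first and third terms in the sum over `τ` have mean zero,
the second is a product of two errors, and the means of the remaining ones are controlled by
assumption. -/
lemma dscore_eq [Fintype T] (n : ℕ) (η : Nuisance T (𝒳 n) (Z n)) (θ : ℝ) (w : 𝒲) :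
    S.dscore n η θ w = ∑ τ, S.coef τ *
      (S.q1⁻¹ * (S.dratio n η τ w * S.resid n τ w * S.G τ w)
        - S.dratio n η τ w * (S.q1⁻¹ * (S.G τ w * S.dm n η τ w))
        + S.dm n η τ w * (S.psib n w (S.eta n) - S.ratio n (S.eta n) τ w * S.G τ w / S.q1)
        + S.dpsib n η w * η.m τ (S.X n w)) - θ * S.dpsib n η w := by
  have h : S.dscore n η θ w = (S.psi n w η - S.psi n w (S.eta n)) - θ * S.dpsib n η w := by
    simp only [dscore, score, dpsib]; ring
  rw [h, psi, psi, ← Finset.sum_sub_distrib]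
  congr 1
  refine Finset.sum_congr rfl fun τ _ => ?_
  simp only [dratio, dm, dpsib, resid, ratio]
  ring

/-- The grouping suited to `L²` norms: `dm` is multiplied by the bounded estimated ratio instead of
`dratio`, and the estimated regression next to `dpsib` is split into the true one and its error. -/
lemma dscore_eq' [Fintype T] (n : ℕ) (η : Nuisance T (𝒳 n) (Z n)) (θ : ℝ) (w : 𝒲) :
    S.dscore n η θ w = ∑ τ, S.coef τ *
      (S.q1⁻¹ * S.G τ w * (S.dratio n η τ w * S.resid n τ w)
        - S.q1⁻¹ * S.G τ w * S.ratio n η τ w * S.dm n η τ w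
        + S.psib n w (S.eta n) * S.dm n η τ w
        + S.dpsib n η w * (S.eta n).m τ (S.X n w)
        + S.dpsib n η w * S.dm n η τ w) - θ * S.dpsib n η w := by
  rw [dscore_eq]
  congr 1
  refine Finset.sum_congr rfl fun τ _ => ?_
  simp only [dratio, dm, dpsib, resid]
  ring

variable {S} {c B : ℝ} {n : ℕ} {η : Nuisance T (𝒳 n) (Z n)}

/-- Measurability and overlap for an estimated nuisance parameter. -/
structure Regular (S : Model T 𝒲 𝒳 Z) (c : ℝ) (n : ℕ) (η : Nuisance T (𝒳 n) (Z n)) : Prop where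
  measurable_q : ∀ τ, Measurable (η.q τ)
  measurable_m : ∀ τ, Measurable (η.m τ)
  measurable_psib : Measurable fun w => S.psib n w η
  bounds : ∀ τ, ∀ᵐ w ∂S.law, c ≤ η.q τ (S.X n w) ∧ η.q τ (S.X n w) ≤ 1 - c

lemma measurable_resid (n : ℕ) (τ : T) : Measurable (S.resid n τ) :=
  S.measurable_Y.sub ((S.measurable_m n τ).comp (S.measurable_X n))

namespace Regular

variable (hη : S.Regular c n η)
include hη

lemma measurable_dm (τ : T) : Measurable (S.dm n η τ) :=
  ((hη.measurable_m τ).comp (S.measurable_X n)).sub ((S.measurable_m n τ).comp (S.measurable_X n))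

lemma measurable_dratio (τ : T) : Measurable (S.dratio n η τ) :=
  (measurable_ratio n hη.measurable_q τ).sub (measurable_ratio n (S.measurable_q n) τ)

lemma measurable_dpsib : Measurable (S.dpsib n η) :=
  hη.measurable_psib.sub (S.measurable_psib_eta n)

lemma ae_abs_ratio_le (hc : 0 < c) (τ : T) : ∀ᵐ w ∂S.law, |S.ratio n η τ w| ≤ c⁻¹ := by
  filter_upwards [hη.bounds S.one, hη.bounds τ] with w h1 hτ
  exact abs_ratio_le hc n τ ⟨hc.le.trans h1.1, by linarith [h1.2]⟩ hτ.1

lemma ae_abs_dratio_le (hc : 0 < c) (hq : S.PropensityBounds c) (τ : T) :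
    ∀ᵐ w ∂S.law, |S.dratio n η τ w| ≤ 2 * c⁻¹ := by
  filter_upwards [hη.ae_abs_ratio_le hc τ, ae_abs_ratio_eta_le hc hq n τ] with w h1 h2
  exact (abs_sub _ _).trans (by linarith)

/-- The bias of the estimated score is of second order. -/
lemma enorm_integral_dscore_le [Fintype T] (hS : S.TrueNuisance) (hc : 0 < c)
    (hq : S.PropensityBounds c) (hY : MemLp S.Y 2 S.law) (hb : S.AdjustmentMean)
    (hB : ∀ᵐ w ∂S.law, |S.psib n w (S.eta n)| ≤ B) (θ : ℝ)
    (hδ : eLpNorm (S.dpsib n η) ∞ S.law < ∞)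
    (hδm : ∀ τ, eLpNorm (fun w => S.dpsib n η w * (S.eta n).m τ (S.X n w)) 2 S.law < ∞)
    (hdm : ∀ τ, eLpNorm (S.dm n η τ) 2 S.law < ∞) :
    ‖∫ w, S.dscore n η θ w ∂S.law‖ₑ
      ≤ ∑ τ, ‖S.coef τ‖ₑ * (ENNReal.ofReal S.q1⁻¹
          * (eLpNorm (S.dratio n η τ) 2 S.law * eLpNorm (S.dm n η τ) 2 S.law)
        + ‖∫ w, S.dpsib n η w * η.m τ (S.X n w) ∂S.law‖ₑ)
        + ‖θ‖ₑ * ‖∫ w, S.dpsib n η w ∂S.law‖ₑ := by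
  have hq1 := q1_pos hS hc hq
  have mδ := hη.measurable_dpsib.aestronglyMeasurable (μ := S.law)
  have mdm := fun τ => (hη.measurable_dm τ).aestronglyMeasurable (μ := S.law)
  have mdr := fun τ => (hη.measurable_dratio τ).aestronglyMeasurable (μ := S.law)
  have mG := fun τ => (S.measurable_G τ).aestronglyMeasurable (μ := S.law)
  have mψ := (S.measurable_psib_eta n).aestronglyMeasurable (μ := S.law)
  have mr := fun τ => (measurable_ratio (S := S) n (S.measurable_q n) τ).aestronglyMeasurable (μ := S.law)
  have iδ : Integrable (S.dpsib n η) S.law :=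
    MemLp.integrable (q := ∞) le_top ⟨mδ, hδ⟩
  have idm : ∀ τ, Integrable (S.dm n η τ) S.law := fun τ =>
    MemLp.integrable (q := 2) (by norm_num) ⟨mdm τ, hdm τ⟩
  have iGdm : ∀ τ, Integrable (fun w => S.q1⁻¹ * (S.G τ w * S.dm n η τ w)) S.law := fun τ =>
    ((idm τ).bdd_mul (mG τ) (ae_of_all _ (S.abs_G_le_one τ))).const_mul _
  have i1 : ∀ τ, Integrable (fun w =>
      S.q1⁻¹ * (S.dratio n η τ w * S.resid n τ w * S.G τ w)) S.law := fun τ => by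
    have hres : Integrable (S.resid n τ) S.law :=
      ((uniformIntegrable_residual hS hc hq hY τ).memLp n).integrable (by norm_num)
    exact ((hres.bdd_mul (mdr τ) (hη.ae_abs_dratio_le hc hq τ)).mul_bdd (mG τ)
      (ae_of_all _ (S.abs_G_le_one τ))).const_mul _
  have i2 : ∀ τ, Integrable (fun w =>
      S.dratio n η τ w * (S.q1⁻¹ * (S.G τ w * S.dm n η τ w))) S.law := fun τ =>
    (iGdm τ).bdd_mul (mdr τ) (hη.ae_abs_dratio_le hc hq τ)
  have i3 : ∀ τ, Integrable (fun w => S.dm n η τ w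
      * (S.psib n w (S.eta n) - S.ratio n (S.eta n) τ w * S.G τ w / S.q1)) S.law := fun τ => by
    refine (idm τ).mul_bdd (c := B + c⁻¹ * 1 / S.q1)
      (mψ.sub (((mr τ).mul (mG τ)).mul_const S.q1⁻¹)) ?_
    filter_upwards [hB, ae_abs_ratio_eta_le hc hq n τ] with w h1 h2
    refine (abs_sub _ _).trans (add_le_add h1 ?_)
    rw [abs_div, abs_mul, abs_of_pos hq1]
    gcongr
    exact S.abs_G_le_one τ w
  -- The estimated regression is the true one plus its error; the latter is paired with the finite
  -- sup norm of `dpsib`.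
  have i4 : ∀ τ, Integrable (fun w => S.dpsib n η w * η.m τ (S.X n w)) S.law := fun τ => by
    have ha : Integrable (fun w => S.dpsib n η w * (S.eta n).m τ (S.X n w)) S.law :=
      MemLp.integrable (q := 2) (by norm_num)
        ⟨mδ.mul ((S.measurable_m n τ).comp (S.measurable_X n)).aestronglyMeasurable, hδm τ⟩
    have hb' : Integrable (fun w => S.dpsib n η w * S.dm n η τ w) S.law := by
      refine MemLp.integrable (q := 2) (by norm_num) ⟨mδ.mul (mdm τ), ?_⟩
      exact (eLpNorm_mul_le_top_mul (mdm τ)).trans_lt (ENNReal.mul_lt_top hδ (hdm τ))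
    refine (ha.add hb').congr (ae_of_all _ fun w => ?_)
    simp only [dm, Pi.add_apply]; ring
  have e1 : ∀ τ, ∫ w, S.q1⁻¹ * (S.dratio n η τ w * S.resid n τ w * S.G τ w) ∂S.law = 0 := by
    intro τ
    rw [integral_const_mul]
    have := integral_comp_X_mul_residual hS hc hq hY τ (n := n)
      (φ := fun x => η.q S.one x / η.q τ x - (S.eta n).q S.one x / (S.eta n).q τ x)
      (((hη.measurable_q _).div (hη.measurable_q _)).sub
        ((S.measurable_q n _).div (S.measurable_q n _))) (hη.ae_abs_dratio_le hc hq τ)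
    exact mul_eq_zero_of_right _ this
  have e3 : ∀ τ, ∫ w, S.dm n η τ w
      * (S.psib n w (S.eta n) - S.ratio n (S.eta n) τ w * S.G τ w / S.q1) ∂S.law = 0 := fun τ =>
    integral_comp_X_mul_psib_sub hS hc hq hb hB τ (φ := fun x => η.m τ x - (S.eta n).m τ x)
      ((hη.measurable_m τ).sub (S.measurable_m n τ)) (idm τ)
  have hI : ∫ w, S.dscore n η θ w ∂S.law = ∑ τ, S.coef τ *
      (-(∫ w, S.dratio n η τ w * (S.q1⁻¹ * (S.G τ w * S.dm n η τ w)) ∂S.law)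
        + ∫ w, S.dpsib n η w * η.m τ (S.X n w) ∂S.law) - θ * ∫ w, S.dpsib n η w ∂S.law := by
    simp_rw [dscore_eq]
    rw [integral_sum_linear_combination i1 i2 i3 i4 iδ]
    simp only [e1, e3]
    congr 1
    refine Finset.sum_congr rfl fun τ _ => ?_
    ring
  rw [hI]
  refine enorm_sub_le.trans (add_le_add ((enorm_sum_le _ _).trans (Finset.sum_le_sum fun τ _ => ?_))
    (enorm_mul _ _).le)
  rw [enorm_mul]
  gcongr
  refine (enorm_add_le _ _).trans (add_le_add ?_ le_rfl)
  rw [enorm_neg]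
  refine (enorm_integral_mul_le (mdr τ) (iGdm τ).1).trans ?_
  rw [mul_left_comm]
  gcongr
  refine eLpNorm_le_mul_eLpNorm_of_ae_le_mul (ae_of_all _ fun w => ?_) 2
  rw [norm_mul, norm_mul, Real.norm_of_nonneg (inv_pos.2 hq1).le]
  gcongr
  exact mul_le_of_le_one_left (norm_nonneg _) (S.abs_G_le_one τ w)

/-- Bounded weights are pulled out of each term of `dscore_eq'`. The product of `dratio` and the
residual is left intact, since the residual is unbounded. -/
lemma eLpNorm_dscore_le [Fintype T] (hS : S.TrueNuisance) (hc : 0 < c)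
    (hq : S.PropensityBounds c) (hB : ∀ᵐ w ∂S.law, |S.psib n w (S.eta n)| ≤ B) (θ : ℝ) :
    eLpNorm (S.dscore n η θ) 2 S.law
      ≤ ∑ τ, ENNReal.ofReal |S.coef τ| *
        (ENNReal.ofReal S.q1⁻¹ * eLpNorm (fun w => S.dratio n η τ w * S.resid n τ w) 2 S.law
        + ENNReal.ofReal (S.q1⁻¹ * c⁻¹) * eLpNorm (S.dm n η τ) 2 S.law
        + ENNReal.ofReal B * eLpNorm (S.dm n η τ) 2 S.law
        + eLpNorm (fun w => S.dpsib n η w * (S.eta n).m τ (S.X n w)) 2 S.law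
        + eLpNorm (S.dpsib n η) ∞ S.law * eLpNorm (S.dm n η τ) 2 S.law)
        + ENNReal.ofReal |θ| * eLpNorm (S.dpsib n η) 2 S.law := by
  have hq1 := q1_pos hS hc hq
  have mδ := hη.measurable_dpsib
  have mdm := hη.measurable_dm
  have mdr := hη.measurable_dratio
  have mG := S.measurable_G
  have mψ := S.measurable_psib_eta n
  have mres := S.measurable_resid n
  have mr := fun τ => measurable_ratio (S := S) n hη.measurable_q τ
  have mm := fun τ => (S.measurable_m n τ).comp (S.measurable_X n)
  set t1 : T → 𝒲 → ℝ := fun τ w => S.q1⁻¹ * S.G τ w * (S.dratio n η τ w * S.resid n τ w) with ht1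
  set t2 : T → 𝒲 → ℝ := fun τ w => S.q1⁻¹ * S.G τ w * S.ratio n η τ w * S.dm n η τ w with ht2
  set t3 : T → 𝒲 → ℝ := fun τ w => S.psib n w (S.eta n) * S.dm n η τ w with ht3
  set t4 : T → 𝒲 → ℝ := fun τ w => S.dpsib n η w * (S.eta n).m τ (S.X n w) with ht4
  set t5 : T → 𝒲 → ℝ := fun τ w => S.dpsib n η w * S.dm n η τ w with ht5
  have m1 : ∀ τ, AEStronglyMeasurable (t1 τ) S.law := fun τ =>
    (((mG τ).const_mul _).mul ((mdr τ).mul (mres τ))).aestronglyMeasurable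
  have m2 : ∀ τ, AEStronglyMeasurable (t2 τ) S.law := fun τ =>
    ((((mG τ).const_mul _).mul (mr τ)).mul (mdm τ)).aestronglyMeasurable
  have m3 : ∀ τ, AEStronglyMeasurable (t3 τ) S.law := fun τ =>
    (mψ.mul (mdm τ)).aestronglyMeasurable
  have m4 : ∀ τ, AEStronglyMeasurable (t4 τ) S.law := fun τ =>
    (mδ.mul (mm τ)).aestronglyMeasurable
  have m5 : ∀ τ, AEStronglyMeasurable (t5 τ) S.law := fun τ =>
    (mδ.mul (mdm τ)).aestronglyMeasurable
  have hΔ : S.dscore n η θ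
      = (∑ τ, S.coef τ • (t1 τ - t2 τ + t3 τ + t4 τ + t5 τ)) - θ • S.dpsib n η := by
    ext w
    rw [dscore_eq']
    simp only [Pi.sub_apply, Finset.sum_apply, Pi.smul_apply, Pi.add_apply, smul_eq_mul, ht1, ht2,
      ht3, ht4, ht5]
  have hsum : ∀ τ, AEStronglyMeasurable (t1 τ - t2 τ + t3 τ + t4 τ + t5 τ) S.law := fun τ =>
    ((((m1 τ).sub (m2 τ)).add (m3 τ)).add (m4 τ)).add (m5 τ)
  have b1 : ∀ τ, eLpNorm (t1 τ) 2 S.law ≤ ENNReal.ofReal S.q1⁻¹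
      * eLpNorm (fun w => S.dratio n η τ w * S.resid n τ w) 2 S.law := fun τ => by
    refine eLpNorm_le_mul_eLpNorm_of_ae_le_mul (ae_of_all _ fun w => ?_) 2
    rw [ht1, norm_mul, norm_mul, Real.norm_of_nonneg (inv_pos.2 hq1).le]
    gcongr
    exact mul_le_of_le_one_right (inv_pos.2 hq1).le (S.abs_G_le_one τ w)
  have b2 : ∀ τ, eLpNorm (t2 τ) 2 S.law ≤ ENNReal.ofReal (S.q1⁻¹ * c⁻¹)
      * eLpNorm (S.dm n η τ) 2 S.law := fun τ => by
    refine eLpNorm_le_mul_eLpNorm_of_ae_le_mul ?_ 2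
    filter_upwards [hη.ae_abs_ratio_le hc τ] with w hw
    rw [ht2, norm_mul, norm_mul, norm_mul, Real.norm_of_nonneg (inv_pos.2 hq1).le]
    gcongr
    · exact mul_le_of_le_one_right (inv_pos.2 hq1).le (S.abs_G_le_one τ w)
    · exact hw
  have b3 : ∀ τ, eLpNorm (t3 τ) 2 S.law ≤ ENNReal.ofReal B
      * eLpNorm (S.dm n η τ) 2 S.law := fun τ => by
    refine eLpNorm_le_mul_eLpNorm_of_ae_le_mul ?_ 2
    filter_upwards [hB] with w hw
    rw [ht3, norm_mul]
    gcongr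
    exact hw
  have b5 : ∀ τ, eLpNorm (t5 τ) 2 S.law
      ≤ eLpNorm (S.dpsib n η) ∞ S.law * eLpNorm (S.dm n η τ) 2 S.law := fun τ =>
    eLpNorm_mul_le_top_mul (mdm τ).aestronglyMeasurable
  have one_le_two' : (1 : ℝ≥0∞) ≤ 2 := by norm_num
  rw [hΔ]
  refine (eLpNorm_sub_le (Finset.aestronglyMeasurable_sum _ fun τ _ => (hsum τ).const_smul _)
    (mδ.aestronglyMeasurable.const_smul θ) one_le_two').trans (add_le_add ?_ ?_)
  · refine (eLpNorm_sum_le (fun τ _ => (hsum τ).const_smul _) one_le_two').trans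
      (Finset.sum_le_sum fun τ _ => ?_)
    rw [eLpNorm_const_smul, ← ofReal_norm, Real.norm_eq_abs]
    gcongr
    refine (eLpNorm_add_le ((((m1 τ).sub (m2 τ)).add (m3 τ)).add (m4 τ)) (m5 τ)
      one_le_two').trans (add_le_add ?_ (b5 τ))
    refine (eLpNorm_add_le (((m1 τ).sub (m2 τ)).add (m3 τ)) (m4 τ)
      one_le_two').trans (add_le_add ?_ le_rfl)
    refine (eLpNorm_add_le ((m1 τ).sub (m2 τ)) (m3 τ)
      one_le_two').trans (add_le_add ?_ (b3 τ))
    exact (eLpNorm_sub_le (m1 τ) (m2 τ) one_le_two').trans (add_le_add (b1 τ) (b2 τ))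
  · rw [eLpNorm_const_smul, ← ofReal_norm, Real.norm_eq_abs]

end Regular

end Model

namespace CrossFit

variable {T 𝒲 : Type*} {𝒳 Z : ℕ → Type*} [MeasurableSpace 𝒲] [∀ n, MeasurableSpace (𝒳 n)]
  {S : Model T 𝒲 𝒳 Z} {K : ℕ} {𝓡 : Type*} [MeasurableSpace 𝓡] (F : CrossFit S K 𝓡)

/-! ### Measurability of the estimated scores -/

section Measurability

variable {n : ℕ}

lemma measurable_qHat_comp (k : Fin K) (τ : T) {β : Type*} [MeasurableSpace β] {r : β → 𝓡}
    {v : β → Fin (K * n) → 𝒲} {x : β → 𝒲} (hr : Measurable r) (hv : Measurable v)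
    (hx : Measurable x) : Measurable fun b => (F.etaHat n k (r b) (v b)).q τ (S.X n (x b)) :=
  (F.measurable_qHat n k τ).comp (hr.prodMk (hv.prodMk ((S.measurable_X n).comp hx)))

lemma measurable_mHat_comp (k : Fin K) (τ : T) {β : Type*} [MeasurableSpace β] {r : β → 𝓡}
    {v : β → Fin (K * n) → 𝒲} {x : β → 𝒲} (hr : Measurable r) (hv : Measurable v)
    (hx : Measurable x) : Measurable fun b => (F.etaHat n k (r b) (v b)).m τ (S.X n (x b)) :=
  (F.measurable_mHat n k τ).comp (hr.prodMk (hv.prodMk ((S.measurable_X n).comp hx)))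

lemma measurable_psibHat_comp (k : Fin K) {β : Type*} [MeasurableSpace β] {r : β → 𝓡}
    {v : β → Fin (K * n) → 𝒲} {x : β → 𝒲} (hr : Measurable r) (hv : Measurable v)
    (hx : Measurable x) : Measurable fun b => S.psib n (x b) (F.etaHat n k (r b) (v b)) :=
  (F.measurable_psibHat n k).comp (hr.prodMk (hv.prodMk hx))

lemma measurable_psiHat_comp [Fintype T] (k : Fin K) {β : Type*} [MeasurableSpace β] {r : β → 𝓡}
    {v : β → Fin (K * n) → 𝒲} {x : β → 𝒲} (hr : Measurable r) (hv : Measurable v)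
    (hx : Measurable x) : Measurable fun b => S.psi n (x b) (F.etaHat n k (r b) (v b)) := by
  refine Finset.measurable_fun_sum _ fun τ _ => Measurable.const_mul ?_ _
  have hq := fun τ => F.measurable_qHat_comp k τ hr hv hx
  have hm := F.measurable_mHat_comp k τ hr hv hx
  exact ((((hq S.one).div_const _).mul (((S.measurable_G τ).comp hx).div (hq τ))).mul
    ((S.measurable_Y.comp hx).sub hm)).add ((F.measurable_psibHat_comp k hr hv hx).mul hm)

lemma measurable_dpsibHat (k : Fin K) : Measurable fun p : 𝓡 × (Fin (K * n) → 𝒲) × 𝒲 =>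
    S.dpsib n (F.etaHat n k p.1 p.2.1) p.2.2 :=
  (F.measurable_psibHat n k).sub ((S.measurable_psib_eta n).comp measurable_snd.snd)

lemma measurable_dscoreHat [Fintype T] (k : Fin K) (θ : ℝ) :
    Measurable fun p : 𝓡 × (Fin (K * n) → 𝒲) × 𝒲 =>
      S.dscore n (F.etaHat n k p.1 p.2.1) θ p.2.2 :=
  ((F.measurable_psiHat_comp k measurable_fst measurable_snd.fst measurable_snd.snd).sub
    ((F.measurable_psibHat n k).mul_const θ)).sub
    ((S.measurable_score n (S.measurable_q n) (S.measurable_m n) (S.measurable_psib_eta n) θ).comp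
      measurable_snd.snd)

lemma measurable_sum_fold {f : Fin K → Fin (K * n) → 𝓡 × (Fin (K * n) → 𝒲) → ℝ}
    (hf : ∀ k i, Measurable (f k i)) : Measurable fun q : 𝓡 × (Fin (K * n) → 𝒲) =>
      ∑ k, ∑ i with F.split n q.1 i = k, f k i q := by
  simp only [Finset.sum_filter]
  refine Finset.measurable_fun_sum _ fun k _ => Finset.measurable_fun_sum _ fun i _ =>
    Measurable.ite ?_ (hf k i) measurable_const
  exact (((measurable_pi_apply i).comp (F.measurable_split n)).comp measurable_fst)
    (measurableSet_singleton k)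

lemma measurable_thetaHat [Fintype T] :
    Measurable fun q : 𝓡 × (Fin (K * n) → 𝒲) => F.thetaHat n q.1 q.2 := by
  refine Measurable.div (Measurable.const_mul (F.measurable_sum_fold fun k i => ?_) _)
    (Measurable.const_mul (F.measurable_sum_fold fun k i => ?_) _)
  · exact F.measurable_psiHat_comp k measurable_fst measurable_snd
      ((measurable_pi_apply i).comp measurable_snd)
  · exact F.measurable_psibHat_comp k measurable_fst measurable_snd
      ((measurable_pi_apply i).comp measurable_snd)

lemma regular_etaHat {c : ℝ} (k : Fin K) (r : 𝓡) (v : Fin (K * n) → 𝒲)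
    (h : ∀ τ, ∀ᵐ w ∂S.law, c ≤ (F.etaHat n k r v).q τ (S.X n w) ∧
      (F.etaHat n k r v).q τ (S.X n w) ≤ 1 - c) : S.Regular c n (F.etaHat n k r v) where
  measurable_q τ := (F.measurable_qHat n k τ).comp
    (measurable_const.prodMk (measurable_const.prodMk measurable_id))
  measurable_m τ := (F.measurable_mHat n k τ).comp
    (measurable_const.prodMk (measurable_const.prodMk measurable_id))
  measurable_psib := (F.measurable_psibHat n k).comp
    (measurable_const.prodMk (measurable_const.prodMk measurable_id))
  bounds := h

end Measurability

/-! ### Negligibility of the first-stage errors -/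

variable {F} {Ω : Type*} [MeasurableSpace Ω] {μ : Measure Ω} {R : Ω → 𝓡} {W : ℕ → Ω → 𝒲}
  {c B : ℝ}

/-- No moment of `Ỹ` beyond the second is needed. Where the residual is below `M`, the product is at
most `M` times the ratio error, small in `L²`; on the tail the ratio error is bounded by `2 c⁻¹` and
uniform integrability makes the residual small. -/
lemma FirstStage.tendsto_dratio_mul_resid (hF : F.FirstStage R W μ) (hS : S.TrueNuisance)
    (hc : 0 < c) (hq : S.PropensityBounds c) (hY : MemLp S.Y 2 S.law) {k : Fin K}
    (hreg : ∀ᶠ p : ℕ × Ω in whp μ, S.Regular c p.1 (F.fit R W p.1 k p.2)) (τ : T) :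
    Tendsto (fun p : ℕ × Ω => eLpNorm (fun w => S.dratio p.1 (F.fit R W p.1 k p.2) τ w
      * S.resid p.1 τ w) 2 S.law) (whp μ) (𝓝 0) := by
  rw [ENNReal.tendsto_nhds_zero]
  intro ε hε
  obtain ⟨η, hη, hηε⟩ := ENNReal.lt_iff_exists_nnreal_btwn.1 (ENNReal.half_pos hε.ne')
  have hη' : (0 : ℝ) < η := by exact_mod_cast hη
  have hb : 0 < 2 * c⁻¹ := by positivity
  obtain ⟨M, hM⟩ := (Model.uniformIntegrable_residual hS hc hq hY τ).spec (by norm_num)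
    (by norm_num) (div_pos hη' hb)
  have hd : Tendsto (fun p : ℕ × Ω => (M : ℝ≥0∞) * eLpNorm (S.dratio p.1 (F.fit R W p.1 k p.2) τ)
      2 S.law) (whp μ) (𝓝 0) := by
    have h := ENNReal.Tendsto.const_mul (hF.ratio_two k τ).tendsto_whp
      (Or.inr (ENNReal.coe_ne_top (r := M)))
    rw [mul_zero] at h
    exact h
  filter_upwards [hreg, ENNReal.tendsto_nhds_zero.1 hd (ε / 2) (ENNReal.half_pos hε.ne')]
    with p hp hpd
  refine (eLpNorm_mul_le_add_tail (hp.measurable_dratio τ) (Model.measurable_resid p.1 τ)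
    (hp.ae_abs_dratio_le hc hq τ) M).trans ?_
  rw [← ENNReal.add_halves ε]
  refine add_le_add hpd (le_trans ?_ hηε.le)
  refine (mul_le_mul_right (hM p.1) _).trans ?_
  rw [← ENNReal.ofReal_mul hb.le, mul_div_cancel₀ _ hb.ne', ENNReal.ofReal_coe_nnreal]

variable [Fintype T]

lemma FirstStage.tendsto_eLpNorm_dscore (hF : F.FirstStage R W μ) (hS : S.TrueNuisance)
    (hc : 0 < c) (hq : S.PropensityBounds c) (hY : MemLp S.Y 2 S.law)
    (hB : ∀ n, ∀ᵐ w ∂S.law, |S.psib n w (S.eta n)| ≤ B) {k : Fin K}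
    (hreg : ∀ᶠ p : ℕ × Ω in whp μ, S.Regular c p.1 (F.fit R W p.1 k p.2)) (θ : ℝ) :
    Tendsto (fun p : ℕ × Ω => eLpNorm (S.dscore p.1 (F.fit R W p.1 k p.2) θ) 2 S.law)
      (whp μ) (𝓝 0) := by
  have hm : ∀ τ, Tendsto (fun p : ℕ × Ω => eLpNorm (S.dm p.1 (F.fit R W p.1 k p.2) τ) 2 S.law)
      (whp μ) (𝓝 0) := fun τ => (hF.m_two k τ).tendsto_whp
  have cm : ∀ (a : ℝ) {f : ℕ × Ω → ℝ≥0∞}, Tendsto f (whp μ) (𝓝 0) →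
      Tendsto (fun p => ENNReal.ofReal a * f p) (whp μ) (𝓝 0) := fun a f hf => by
    simpa using ENNReal.Tendsto.const_mul hf (Or.inr (ENNReal.ofReal_ne_top (r := a)))
  have hterm : ∀ τ, Tendsto (fun p : ℕ × Ω => ENNReal.ofReal |S.coef τ| *
        (ENNReal.ofReal S.q1⁻¹ * eLpNorm (fun w => S.dratio p.1 (F.fit R W p.1 k p.2) τ w
            * S.resid p.1 τ w) 2 S.law
        + ENNReal.ofReal (S.q1⁻¹ * c⁻¹) * eLpNorm (S.dm p.1 (F.fit R W p.1 k p.2) τ) 2 S.law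
        + ENNReal.ofReal B * eLpNorm (S.dm p.1 (F.fit R W p.1 k p.2) τ) 2 S.law
        + eLpNorm (fun w => S.dpsib p.1 (F.fit R W p.1 k p.2) w
            * (S.eta p.1).m τ (S.X p.1 w)) 2 S.law
        + eLpNorm (S.dpsib p.1 (F.fit R W p.1 k p.2)) ∞ S.law
            * eLpNorm (S.dm p.1 (F.fit R W p.1 k p.2) τ) 2 S.law)) (whp μ) (𝓝 0) := by
    intro τ
    refine cm _ ?_
    have h1 := cm S.q1⁻¹ (hF.tendsto_dratio_mul_resid hS hc hq hY hreg τ)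
    have h2 := cm (S.q1⁻¹ * c⁻¹) (hm τ)
    have h3 := cm B (hm τ)
    have h4 := (hF.psib_m k τ).tendsto_whp
    have h5 := tendsto_whp_mul_of_bigOpOne (hF.psib_top k) (hF.m_two k τ).tendsto_whp
    have h := (((h1.add h2).add h3).add h4).add h5
    simp only [add_zero] at h
    exact h
  have hsum := (tendsto_finsetSum Finset.univ fun τ _ => hterm τ).add
    (cm |θ| (hF.psib_two k).tendsto_whp)
  simp only [Finset.sum_const_zero, add_zero] at hsum
  refine tendsto_of_tendsto_of_tendsto_of_le_of_le' tendsto_const_nhds hsum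
    (Eventually.of_forall fun _ => bot_le) ?_
  filter_upwards [hreg] with p hp
  exact hp.eLpNorm_dscore_le hS hc hq (hB p.1) θ

lemma FirstStage.tendsto_integral_dscore (hF : F.FirstStage R W μ) (hK : 0 < K)
    (hS : S.TrueNuisance) (hc : 0 < c) (hq : S.PropensityBounds c) (hY : MemLp S.Y 2 S.law)
    (hb : S.AdjustmentMean) (hB : ∀ n, ∀ᵐ w ∂S.law, |S.psib n w (S.eta n)| ≤ B) {k : Fin K}
    (hreg : ∀ᶠ p : ℕ × Ω in whp μ, S.Regular c p.1 (F.fit R W p.1 k p.2)) (θ : ℝ) :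
    Tendsto (fun p : ℕ × Ω => ENNReal.ofReal √((K * p.1 : ℕ) : ℝ)
      * ‖∫ w, S.dscore p.1 (F.fit R W p.1 k p.2) θ w ∂S.law‖ₑ) (whp μ) (𝓝 0) := by
  have cm : ∀ (a : ℝ≥0∞) {f : ℕ × Ω → ℝ≥0∞}, a ≠ ∞ → Tendsto f (whp μ) (𝓝 0) →
      Tendsto (fun p => a * f p) (whp μ) (𝓝 0) := fun a f ha hf => by
    simpa using ENNReal.Tendsto.const_mul hf (Or.inr ha)
  have hterm : ∀ τ, Tendsto (fun p : ℕ × Ω => ‖S.coef τ‖ₑ *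
        (ENNReal.ofReal S.q1⁻¹ * (ENNReal.ofReal √((K * p.1 : ℕ) : ℝ)
          * (F.ratioErr R W k τ p.1 p.2 * F.mErr R W k τ p.1 p.2))
        + ENNReal.ofReal √((K * p.1 : ℕ) : ℝ) * ‖∫ w, F.psibErr R W p.1 k p.2 w
          * (F.fit R W p.1 k p.2).m τ (S.X p.1 w) ∂S.law‖ₑ)) (whp μ) (𝓝 0) := by
    intro τ
    refine cm _ enorm_ne_top ?_
    have h := (cm (ENNReal.ofReal S.q1⁻¹) ENNReal.ofReal_ne_top
      ((hF.product k τ).tendsto_whp_rootRate hK)).add ((hF.psib_mHat k τ).tendsto_whp_rootRate hK)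
    simp only [add_zero] at h
    exact h
  have hsum := (tendsto_finsetSum Finset.univ fun τ _ => hterm τ).add
    (cm ‖θ‖ₑ enorm_ne_top ((hF.psib_mean k).tendsto_whp_rootRate hK))
  simp only [Finset.sum_const_zero, add_zero] at hsum
  refine tendsto_of_tendsto_of_tendsto_of_le_of_le' tendsto_const_nhds hsum
    (Eventually.of_forall fun _ => bot_le) ?_
  -- Quantities tending to zero in `[0, ∞]` are eventually finite, which gives the integrability
  -- that the bias bound requires.
  have hmtop : ∀ᶠ p : ℕ × Ω in whp μ, ∀ τ, F.mErr R W k τ p.1 p.2 < ∞ :=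
    eventually_all.2 fun τ => (hF.m_two k τ).tendsto_whp.eventually_lt_const ENNReal.zero_lt_top
  have hδtop : ∀ᶠ p : ℕ × Ω in whp μ, ∀ τ, eLpNorm (fun w => F.psibErr R W p.1 k p.2 w
      * (S.eta p.1).m τ (S.X p.1 w)) 2 S.law < ∞ :=
    eventually_all.2 fun τ => (hF.psib_m k τ).tendsto_whp.eventually_lt_const ENNReal.zero_lt_top
  filter_upwards [hreg, hmtop, hδtop, (hF.psib_top k).eventually_lt_top] with p hp hm hδm hδ
  refine (mul_le_mul_right (hp.enorm_integral_dscore_le hS hc hq hY hb (hB p.1) θ hδ hδm hm)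
    _).trans (le_of_eq ?_)
  rw [mul_add, Finset.mul_sum]
  congr 1
  · refine Finset.sum_congr rfl fun τ _ => ?_
    change ENNReal.ofReal _ * (‖S.coef τ‖ₑ * (ENNReal.ofReal S.q1⁻¹
      * (F.ratioErr R W k τ p.1 p.2 * F.mErr R W k τ p.1 p.2)
      + ‖∫ w, F.psibErr R W p.1 k p.2 w * (F.fit R W p.1 k p.2).m τ (S.X p.1 w) ∂S.law‖ₑ)) = _
    ring
  · rw [mul_left_comm]
    rfl

end CrossFit

/-! ### Asymptotic linearity and normality -/

section Main

variable {T 𝒲 𝓡 Ω : Type*} {𝒳 Z : ℕ → Type*} [Fintype T]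
  [MeasurableSpace 𝒲] [∀ n, MeasurableSpace (𝒳 n)] [MeasurableSpace 𝓡] [MeasurableSpace Ω]
  {S : Model T 𝒲 𝒳 Z} {μ : Measure Ω} {W : ℕ → Ω → 𝒲} {R : Ω → 𝓡} {K : ℕ} {F : CrossFit S K 𝓡}
  {θ : ℝ}

/-- The decomposition of the estimation error into the oracle average, the error of the score and
the error of the denominator. -/
lemma sqrt_mul_thetaHat_sub_eq {n : ℕ} (hN : 0 < K * n) (r : 𝓡) (v : Fin (K * n) → 𝒲)
    {D A E : ℝ}
    (hD : D = 1 / ((K * n : ℕ) : ℝ) * ∑ i, S.psib n (v i) (S.eta n)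
      + 1 / ((K * n : ℕ) : ℝ) * ∑ k, ∑ i with F.split n r i = k, S.dpsib n (F.etaHat n k r v) (v i))
    (hD0 : D ≠ 0)
    (hA : A = 1 / √((K * n : ℕ) : ℝ) * ∑ i, S.score n (v i) (S.eta n) θ)
    (hE : E = 1 / √((K * n : ℕ) : ℝ)
      * ∑ k, ∑ i with F.split n r i = k, S.dscore n (F.etaHat n k r v) θ (v i)) :
    √((K * n : ℕ) : ℝ) * (F.thetaHat n r v - θ) - A = (A * (1 - D) + E) / D := by
  have hN' : (0 : ℝ) < ((K * n : ℕ) : ℝ) := by exact_mod_cast hN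
  set N : ℝ := ((K * n : ℕ) : ℝ) with hNdef
  have hs : 0 < √N := Real.sqrt_pos.2 hN'
  have hsN : √N * √N = N := Real.mul_self_sqrt hN'.le
  set P : ℝ := ∑ k, ∑ i with F.split n r i = k, S.psi n (v i) (F.etaHat n k r v) with hP
  set Q : ℝ := ∑ k, ∑ i with F.split n r i = k, S.psib n (v i) (F.etaHat n k r v) with hQ
  have hDQ : D = 1 / N * Q := by
    -- The folds partition the sample, so the oracle sum is regrouped by folds and absorbed into the
    -- sum of errors.
    rw [hD, ← mul_add, hQ, ← Finset.sum_fiberwise Finset.univ (F.split n r)]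
    simp only [← Finset.sum_add_distrib, Model.dpsib, add_sub_cancel]
  have hAE : A + E = 1 / √N * (P - Q * θ) := by
    rw [hA, hE, ← mul_add, hP, hQ, ← Finset.sum_fiberwise Finset.univ (F.split n r)]
    simp only [← Finset.sum_add_distrib, Model.dscore, add_sub_cancel, Model.score,
      Finset.sum_mul, ← Finset.sum_sub_distrib]
  have hθ : F.thetaHat n r v = 1 / N * P / D := by
    rw [hDQ]; rfl
  rw [eq_div_iff hD0, hθ]
  have h1 : √N * (1 / N * P / D - θ) * D = A + E := by
    have h2 : 1 / √N = √N * (1 / N) := by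
      rw [one_div, one_div]
      nth_rewrite 3 [← hsN]
      rw [mul_inv, mul_inv_cancel_left₀ hs.ne']
    rw [hAE, mul_assoc, sub_mul, div_mul_cancel₀ _ hD0, hDQ, h2]
    ring
  linear_combination h1

lemma exists_common_bound (hq : S.PropensityBounded) (hqHat : F.PropensityBounded R W μ) :
    ∃ c : ℝ, 0 < c ∧ S.PropensityBounds c ∧
      ∀ k, ∀ᶠ p : ℕ × Ω in whp μ, S.Regular c p.1 (F.fit R W p.1 k p.2) := by
  obtain ⟨c₁, h1, hq1⟩ := hq
  obtain ⟨c₂, h2, hq2⟩ := hqHat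
  refine ⟨min c₁ c₂, lt_min h1 h2, fun n τ => ?_, fun k => eventually_whp_of_ae fun n => ?_⟩
  · filter_upwards [hq1 n τ] with w hw
    exact ⟨(min_le_left _ _).trans hw.1, hw.2.trans (by linarith [min_le_left c₁ c₂])⟩
  · filter_upwards [ae_all_iff.2 fun τ => hq2 n k τ] with ω hω
    refine F.regular_etaHat k _ _ fun τ => ?_
    filter_upwards [hω τ] with w hw
    exact ⟨(min_le_right _ _).trans hw.1, hw.2.trans (by linarith [min_le_right c₁ c₂])⟩

lemma tendsto_one_div_sqrt_whp (hK : 0 < K) :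
    Tendsto (fun p : ℕ × Ω => 1 / √((K * p.1 : ℕ) : ℝ)) (whp μ) (𝓝 0) := by
  have h : Tendsto (fun n : ℕ => 1 / √((K * n : ℕ) : ℝ)) atTop (𝓝 0) := by
    simp only [one_div]
    exact tendsto_inv_atTop_zero.comp (Real.tendsto_sqrt_atTop.comp
      (tendsto_natCast_atTop_atTop.comp (tendsto_id.const_mul_atTop' hK)))
  exact h.comp tendsto_fst_whp

lemma tendsto_whp_thetaHat (hS : S.TrueNuisance) [IsProbabilityMeasure μ]
    (hW : ∀ i, Measurable (W i)) (hlaw : ∀ i, μ.map (W i) = S.law) (hindep : iIndepFun W μ)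
    (hR : Measurable R) (hRW : IndepFun R (fun ω i => W i ω) μ) (hK : 0 < K)
    (hθ : ∀ n, ∫ w, S.score n w (S.eta n) θ ∂S.law = 0) (hY : MemLp S.Y 2 S.law)
    (hq : S.PropensityBounded) (hqHat : F.PropensityBounded R W μ) (hb : S.AdjustmentMean)
    (hbC : S.AdjustmentBounded) (hF : F.FirstStage R W μ) :
    Tendsto (fun p : ℕ × Ω =>
        √((K * p.1 : ℕ) : ℝ) * (F.thetaHat p.1 (R p.2) (fun i => W i p.2) - θ)
          - 1 / √((K * p.1 : ℕ) : ℝ) * ∑ i : Fin (K * p.1), S.score p.1 (W i p.2) (S.eta p.1) θ)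
      (whp μ) (𝓝 0) := by
  obtain ⟨c, hc, hqc, hreg⟩ := exists_common_bound hq hqHat
  obtain ⟨B, hB0, hB⟩ := Model.exists_abs_psib_le hS hc hqc hbC
  have hsqrt := tendsto_one_div_sqrt_whp (μ := μ) hK
  have hE : Tendsto (fun p : ℕ × Ω => 1 / √((K * p.1 : ℕ) : ℝ) * ∑ k,
      ∑ i with F.split p.1 (R p.2) i = k, S.dscore p.1
        (F.etaHat p.1 k (R p.2) fun i => W i p.2) θ (W i p.2)) (whp μ) (𝓝 0) := by
    have h := tendsto_finsetSum (Finset.univ : Finset (Fin K)) fun k _ =>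
      tendsto_whp_sum_fold hW hlaw hindep hR hRW hK F.measurable_split k
        (fun n r => F.card_fold n r k)
        (h := fun n r v => S.dscore n (F.etaHat n k r v) θ)
        (fun n => F.measurable_dscoreHat k θ)
        (fun n r v v' hv => congrArg (fun η => S.dscore n η θ) (F.dependsOn n k r hv))
        (hF.tendsto_eLpNorm_dscore hS hc hqc hY hB (hreg k) θ)
        (hF.tendsto_integral_dscore hK hS hc hqc hY hb hB (hreg k) θ)
    simp only [Finset.sum_const_zero] at h
    exact h.congr fun p => (Finset.mul_sum _ _ _).symm
  -- This is stronger than the denominator needs: only a further factor `1 / √N` turns it into an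
  -- average.
  have hD' : Tendsto (fun p : ℕ × Ω => 1 / √((K * p.1 : ℕ) : ℝ) * ∑ k,
      ∑ i with F.split p.1 (R p.2) i = k, S.dpsib p.1
        (F.etaHat p.1 k (R p.2) fun i => W i p.2) (W i p.2)) (whp μ) (𝓝 0) := by
    have h := tendsto_finsetSum (Finset.univ : Finset (Fin K)) fun k _ =>
      tendsto_whp_sum_fold hW hlaw hindep hR hRW hK F.measurable_split k
        (fun n r => F.card_fold n r k)
        (h := fun n r v => S.dpsib n (F.etaHat n k r v))
        (fun n => F.measurable_dpsibHat k)
        (fun n r v v' hv => congrArg (S.dpsib n) (F.dependsOn n k r hv))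
        (hF.psib_two k).tendsto_whp
        ((hF.psib_mean k).tendsto_whp_rootRate hK)
    simp only [Finset.sum_const_zero] at h
    exact h.congr fun p => (Finset.mul_sum _ _ _).symm
  have hui := Model.uniformIntegrable_score hS hc hqc hY hB θ
  obtain ⟨C, hC⟩ := hui.2.2
  have hAO := bigOpOne_normalized_sum (s := fun n w => S.score n w (S.eta n) θ) hW hlaw hindep K
    (fun n => Model.measurable_score n (S.measurable_q n) (S.measurable_m n)
      (S.measurable_psib_eta n) θ) hθ hC
  have hPO := bigOpOne_normalized_sum (s := fun n w => S.psib n w (S.eta n) - 1) (C := (B + 1).toNNReal)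
    hW hlaw hindep K (fun n => (S.measurable_psib_eta n).sub measurable_const)
    (fun n => by
      have hi : Integrable (fun w => S.psib n w (S.eta n)) S.law :=
        Integrable.of_bound (S.measurable_psib_eta n).aestronglyMeasurable B (hB n)
      rw [integral_sub hi (integrable_const _), Model.integral_psib hS hc hqc hb (hB n)]
      simp)
    (fun n => by
      have h : ∀ᵐ w ∂S.law, ‖S.psib n w (S.eta n) - 1‖ ≤ B + 1 := by
        filter_upwards [hB n] with w hw
        refine (norm_sub_le _ _).trans (add_le_add hw (by simp))
      have h' := eLpNorm_le_of_ae_bound (p := 2) h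
      simp only [measure_univ, ENNReal.one_rpow, one_mul] at h'
      exact h')
  -- A law of large numbers for `ψ^b(W, η)`: the average of `ψ^b - 1` is a sum bounded in
  -- probability times `1 / √N`.
  have hP : Tendsto (fun p : ℕ × Ω => (1 / √((K * p.1 : ℕ) : ℝ)
      * ∑ i : Fin (K * p.1), (S.psib p.1 (W i p.2) (S.eta p.1) - 1))
      * (1 / √((K * p.1 : ℕ) : ℝ))) (whp μ) (𝓝 0) :=
    tendsto_whp_mul_of_bigOpOne_real (f := fun n ω => 1 / √((K * n : ℕ) : ℝ)
      * ∑ i : Fin (K * n), (S.psib n (W i ω) (S.eta n) - 1))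
      (g := fun n _ => 1 / √((K * n : ℕ) : ℝ)) hPO hsqrt
  set D : ℕ × Ω → ℝ := fun p => 1 / ((K * p.1 : ℕ) : ℝ) * ∑ i : Fin (K * p.1),
      S.psib p.1 (W i p.2) (S.eta p.1)
      + 1 / ((K * p.1 : ℕ) : ℝ) * ∑ k, ∑ i with F.split p.1 (R p.2) i = k,
        S.dpsib p.1 (F.etaHat p.1 k (R p.2) fun i => W i p.2) (W i p.2) with hD
  have hpos : ∀ᶠ p : ℕ × Ω in whp μ, 0 < K * p.1 :=
    (tendsto_fst_whp.eventually (eventually_gt_atTop 0)).mono fun p hp => Nat.mul_pos hK hp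
  have hD1 : Tendsto D (whp μ) (𝓝 1) := by
    have h := ((hP.add (hD'.mul hsqrt)).const_add 1)
    simp only [mul_zero, add_zero] at h
    refine h.congr' ?_
    filter_upwards [hpos] with p hp
    have hN : (0 : ℝ) < ((K * p.1 : ℕ) : ℝ) := by exact_mod_cast hp
    have hss : 1 / √((K * p.1 : ℕ) : ℝ) * (1 / √((K * p.1 : ℕ) : ℝ)) = 1 / ((K * p.1 : ℕ) : ℝ) := by
      rw [div_mul_div_comm, one_mul, Real.mul_self_sqrt hN.le]
    simp only [hD]
    rw [Finset.sum_sub_distrib, mul_right_comm, hss, mul_right_comm, hss, mul_sub]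
    have : 1 / ((K * p.1 : ℕ) : ℝ) * ∑ _i : Fin (K * p.1), (1 : ℝ) = 1 := by
      simp only [Finset.sum_const, Finset.card_univ, Fintype.card_fin, nsmul_eq_mul, mul_one]
      field_simp
    rw [this]
    ring
  have hA : Tendsto (fun p : ℕ × Ω => (1 / √((K * p.1 : ℕ) : ℝ)
      * ∑ i : Fin (K * p.1), S.score p.1 (W i p.2) (S.eta p.1) θ) * (1 - D p)) (whp μ) (𝓝 0) := by
    have h1D : Tendsto (fun p => 1 - D p) (whp μ) (𝓝 0) := by
      simpa using hD1.const_sub 1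
    exact tendsto_whp_mul_of_bigOpOne_real (f := fun n ω => 1 / √((K * n : ℕ) : ℝ)
      * ∑ i : Fin (K * n), S.score n (W i ω) (S.eta n) θ) (g := fun n ω => 1 - D (n, ω)) hAO h1D
  have hfin := (hA.add hE).div hD1 one_ne_zero
  simp only [add_zero, zero_div] at hfin
  refine hfin.congr' ?_
  filter_upwards [hpos, hD1.eventually_ne one_ne_zero] with p hp hp0
  exact (sqrt_mul_thetaHat_sub_eq hp (R p.2) (fun i => W i p.2) rfl hp0 rfl rfl).symm

lemma tendstoInDistribution_normalized_score (hS : S.TrueNuisance) [IsProbabilityMeasure μ]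
    (hW : ∀ i, Measurable (W i)) (hlaw : ∀ i, μ.map (W i) = S.law) (hindep : iIndepFun W μ)
    (hK : 0 < K) (hθ : ∀ n, ∫ w, S.score n w (S.eta n) θ ∂S.law = 0) (hY : MemLp S.Y 2 S.law)
    (hq : S.PropensityBounded) (hbC : S.AdjustmentBounded) {σsq : ℝ≥0}
    (hσ : Tendsto (fun n => ∫ w, S.score n w (S.eta n) θ ^ 2 ∂S.law) atTop (𝓝 (σsq : ℝ))) :
    TendstoInDistribution (fun (n : ℕ) ω =>
        1 / √((K * n : ℕ) : ℝ) * ∑ i : Fin (K * n), S.score n (W i ω) (S.eta n) θ)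
      atTop (id : ℝ → ℝ) (fun _ => μ) (gaussianReal 0 σsq) := by
  obtain ⟨c, hc, hqc⟩ := hq
  obtain ⟨B, -, hB⟩ := Model.exists_abs_psib_le hS hc hqc hbC
  obtain ⟨hm, hu, C, hC⟩ := Model.uniformIntegrable_score hS hc hqc hY hB θ
  have hdiv : Tendsto (fun m : ℕ => m / K) atTop atTop := Nat.tendsto_div_const_atTop hK.ne'
  -- The limit theorem has rows of every length `m`, whereas the scores are indexed by the fold
  -- size. Row `m` is given the score with index `m / K`, and the result is restricted to `m = K n`.
  have h := tendstoInDistribution_triangular (s := fun m w => S.score (m / K) w (S.eta (m / K)) θ)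
    hW hlaw hindep
    (fun m => Model.measurable_score _ (S.measurable_q _) (S.measurable_m _)
      (S.measurable_psib_eta _) θ)
    ⟨fun m => hm _, fun ε hε => by
      obtain ⟨δ, hδ, h⟩ := hu hε
      exact ⟨δ, hδ, fun m => h _⟩, C, fun m => hC _⟩
    (fun m => hθ _) (hσ.comp hdiv)
  have e : (fun (n : ℕ) ω =>
      1 / √((K * n : ℕ) : ℝ) * ∑ i : Fin (K * n), S.score n (W i ω) (S.eta n) θ)
      = fun n ω => (√((K * n : ℕ) : ℝ))⁻¹ * ∑ i ∈ Finset.range (K * n),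
        S.score (K * n / K) (W i ω) (S.eta (K * n / K)) θ := by
    ext n ω
    rw [one_div, ← Fin.sum_univ_eq_sum_range
      (fun i => S.score (K * n / K) (W i ω) (S.eta (K * n / K)) θ), Nat.mul_div_cancel_left n hK]
  rw [e]
  exact ⟨fun n => h.forall_aemeasurable (K * n), h.aemeasurable_limit,
    h.tendsto.comp (tendsto_id.const_mul_atTop' hK)⟩

/-- Slutsky's theorem. -/
lemma tendstoInDistribution_of_sub {Ω Ω' : Type*} [MeasurableSpace Ω] [MeasurableSpace Ω']
    {μ : Measure Ω} [IsProbabilityMeasure μ] {ν : Measure Ω'} [IsProbabilityMeasure ν]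
    {f g : ℕ → Ω → ℝ} {z : Ω' → ℝ}
    (hg : TendstoInDistribution g atTop z (fun _ => μ) ν)
    (hfg : TendstoInMeasure μ (fun n ω => f n ω - g n ω) atTop fun _ => 0)
    (hf : ∀ n, AEMeasurable (f n) μ) :
    TendstoInDistribution f atTop z (fun _ => μ) ν :=
  tendstoInDistribution_of_tendstoInMeasure_sub f z hg hfg hf

lemma measurable_device_sample (hR : Measurable R) (hW : ∀ i, Measurable (W i)) (n : ℕ) :
    Measurable fun ω => (R ω, fun i : Fin (K * n) => W i ω) :=
  hR.prodMk (measurable_pi_lambda _ fun i => hW i)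

lemma measurable_thetaHat_comp (hR : Measurable R) (hW : ∀ i, Measurable (W i))
    (F : CrossFit S K 𝓡) (n : ℕ) : Measurable fun ω => F.thetaHat n (R ω) fun i => W i ω := by
  have h := (CrossFit.measurable_thetaHat (n := n) F).comp
    (measurable_device_sample (K := K) hR hW n)
  exact h

lemma aemeasurable_sqrt_mul_thetaHat_sub (hR : Measurable R) (hW : ∀ i, Measurable (W i))
    (F : CrossFit S K 𝓡) (θ : ℝ) (n : ℕ) :
    AEMeasurable (fun ω =>
      √((K * n : ℕ) : ℝ) * (F.thetaHat n (R ω) (fun i => W i ω) - θ)) μ := by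
  have h := measurable_thetaHat_comp hR hW F n
  exact ((h.sub_const θ).const_mul _).aemeasurable

end Main

end CrossFitting

open CrossFitting in
theorem theorem3
    {T 𝒲 𝓡 Ω : Type*} {𝒳 Z : ℕ → Type*} [Fintype T]
    [MeasurableSpace 𝒲] [∀ n, MeasurableSpace (𝒳 n)] [MeasurableSpace 𝓡] [MeasurableSpace Ω]
    -- population, score and true nuisance parameters
    (S : Model T 𝒲 𝒳 Z) (hS : S.TrueNuisance)
    -- the i.i.d. sample, and a randomization device independent of it
    (μ : Measure Ω) [IsProbabilityMeasure μ] (W : ℕ → Ω → 𝒲) (R : Ω → 𝓡)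
    (hW : ∀ i, Measurable (W i)) (hlaw : ∀ i, μ.map (W i) = S.law) (hindep : iIndepFun W μ)
    (hR : Measurable R) (hRW : IndepFun R (fun ω i => W i ω) μ)
    -- the cross-fitting procedure with a fixed number of folds
    (K : ℕ) (hK : 0 < K) (F : CrossFit S K 𝓡)
    -- the moment condition that identifies the parameter
    (θ : ℝ) (hθ : ∀ n, ∫ w, S.score n w (S.eta n) θ ∂S.law = 0)
    -- existence of the second moment of the outcome
    (hY : MemLp S.Y 2 S.law)
    -- propensity scores and their estimators are bounded away from zero and one
    (hq : S.PropensityBounded) (hqHat : F.PropensityBounded R W μ)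
    -- behaviour of the adjustment term
    (hb : S.AdjustmentMean) (hbC : S.AdjustmentBounded)
    -- first-stage convergence
    (hF : F.FirstStage R W μ) :
    -- asymptotic linearity
    TendstoInMeasure μ
      (fun (n : ℕ) ω =>
        √((K * n : ℕ) : ℝ) * (F.thetaHat n (R ω) (fun i => W i ω) - θ)
          - 1 / √((K * n : ℕ) : ℝ) * ∑ i : Fin (K * n), S.score n (W i ω) (S.eta n) θ)
      atTop (fun _ => 0) ∧
    -- asymptotic normality; `σsq` is `E[ψ(W, η; θ)^2]`, as a limit if the covariates vary with `n`
    ∀ σsq : ℝ≥0,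
      Tendsto (fun n => ∫ w, S.score n w (S.eta n) θ ^ 2 ∂S.law) atTop (𝓝 (σsq : ℝ)) →
      TendstoInDistribution
        (fun (n : ℕ) ω => √((K * n : ℕ) : ℝ) * (F.thetaHat n (R ω) (fun i => W i ω) - θ))
        atTop (id : ℝ → ℝ) (fun _ => μ) (gaussianReal 0 σsq) := by
  have h0 := tendsto_whp_thetaHat hS hW hlaw hindep hR hRW hK hθ hY hq hqHat hb hbC hF
  have hlin := tendstoInMeasure_zero_of_tendsto_whp
    (f := fun n ω => √((K * n : ℕ) : ℝ) * (F.thetaHat n (R ω) (fun i => W i ω) - θ)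
      - 1 / √((K * n : ℕ) : ℝ) * ∑ i : Fin (K * n), S.score n (W i ω) (S.eta n) θ) h0
  refine ⟨hlin, fun σsq hσ => ?_⟩
  have hd := tendstoInDistribution_normalized_score hS hW hlaw hindep hK hθ hY hq hbC hσ
  exact tendstoInDistribution_of_sub hd hlin (aemeasurable_sqrt_mul_thetaHat_sub hR hW F θ)
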